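/- **Setting.** Let $M\subseteq\mathbb R^N$ be a $N$-dimensional configuration manifold (an open subset of $\mathbb R^N$) and consider the driftless control-affine system $\Sigma$: $\dot x=\sum_{i=1}^m u_i\,g_i(x)$, with $g_1,\dots,g_m$ smooth vector fields on $M$ and controls $u\in U$, where $U\subset\mathbb R^m$ is closed, bounded, symmetric about $0$, and $0$ is interior to the convex hull of $U$. A trajectory is a continuous $x:[0,T]\to M$ generated by a measurable control $u:[0,T]\to U$; its cost is its Euclidean arc length $\ell(x)=\int_0^T\|\dot x\|\,dt$. Let $d(p,q)\in[0,\infty]$ be the infimum of the lengths of the trajectories from $p$ to $q$. Let $L^k(x)\subseteq\mathbb R^N$ be the span at $x$ of the iterated Lie brackets of the $g_i$ with at most $k$ terms, $n_k(x)=\dim L^k(x)$, $w_i(x)=\min\{k: i\le n_k(x)\}$ for $1\le i\le N$, and $s(x)=\min\{k:L^k(x)=\mathbb R^N\}$. For each $x_0\in M$ fix privileged coordinates $z_1,\dots,z_N$ at $x_0$: $z_i=y_i+\mathrm{poly}_i(y_1,\dots,y_{i-1})$, where $y$ are the linear coordinates, centred at $x_0$, of an orthonormal basis adapted to the flag $L^1(x_0)\subseteq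 L^2(x_0)\subseteq\cdots$, $\mathrm{poly}_i$ has only terms of degree $\ge 2$ and $<w_i(x_0)$, and all iterated derivatives of $z_i$ along fewer than $w_i(x_0)$ of the $g_j$ vanish at $x_0$. Put $\|x\|_{x_0}=\max_i|z_i(x)|^{1/w_i(x_0)}$. **Assumptions $A_\Sigma$.** (a) $\bigcup_k L^k(x)=\mathbb R^N$ for all $x\in M$. (b) Every $x\in M$ has a neighbourhood on which all $n_k$ are constant. (c) There are constants $0<a_{\min}\le A_{\max}$ and $\sigma_{\min}>0$ such that $a_{\min}\|x\|_{x_0}\le d(x_0,x)\le A_{\max}\|x\|_{x_0}$ for all $x_0,x\in M$ with $d(x_0,x)<\sigma_{\min}$. (d) There is $\theta_{\min}>0$ such that $\|x_0-x\|\le d(x_0,x)\le 2A_{\max}\|x_0-x\|^{1/s(x_0)}$ for all $x_0,x\in M$ with $\|x_0-x\|\le\theta_{\min}$. **Planning problem.** Let $M_{\rm obs}\subseteq M$ with $M\setminus M_{\rm obs}$ open, let $M_{\rm free}$ be the closure of $M\setminus M_{\rm obs}$ in $M$, of finite Lebesgue measure $\mu(M_{\rm free})$, let $x_{\rm init}\in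 M_{\rm free}$, and let $M_{\rm goal}\subseteq M_{\rm free}$ be relatively open. Let $D=\sum_i w_i(x_{\rm init})$ (the same number at every point if $M$ is connected). A trajectory is collision-free if it stays in $M_{\rm free}$, and feasible if moreover it starts at $x_{\rm init}$ and ends in $\overline{M_{\rm goal}}$. A collision-free trajectory has strong $\delta$-clearance if all its points have Euclidean distance at least $\delta$ from every point of $M_{\rm obs}$. It has weak $\delta$-clearance if there is a homotopy $\psi$ with fixed endpoints from $\psi(0)=x$ to a trajectory $\psi(1)$ with strong $\delta$-clearance such that, for each $\alpha\in(0,1]$, $\psi(\alpha)$ is a trajectory with strong $\delta_\alpha$-clearance for some $\delta_\alpha>0$, and $\ell(\psi(\alpha))\to\ell(x)$ as $\alpha\to0^+$. The goal is $\xi$-regular if for every $y\in\partial M_{\rm goal}$ (boundary in $M$) there is $z\in M_{\rm goal}$ such that the open Euclidean ball of radius $\xi$ about $z$ lies in $M_{\rm goal}$ and $\|y-z\|=\xi$. **DPRM*.** For some pairs $(p,q)$ of points of $M$, including, locally uniformly, all pairs of sufficiently close points, a steering procedure provides an edge $(p,q)$: a trajectory from $p$ to $q$ of minimal length $d(p,q)$,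 neglecting obstacles. $\mathrm{CollisionFree}(p,q)$ holds if the edge $(p,q)$ is provided and does not meet $M_{\rm obs}$. Given a sample size $n$ and a radius $r$, let $V$ consist of $x_{\rm init}$ and $n$ independent uniformly distributed points of $M_{\rm free}$, and let $G$ be the undirected graph on $V$ with the edges $\{u,v\}$, $u\neq v$, such that, for one of the two orders of $u$ and $v$, $\|u\|_v<r/a_{\min}$ and $\mathrm{CollisionFree}(u,v)$. The algorithm returns a path in $G$ from $x_{\rm init}$ to a vertex in $V\cap M_{\rm goal}$ of minimal cost, the cost of a path being the sum of $d(u,v)$ over its edges; the cost is $\infty$ if there is no such path (failure). **Corollary (DPRM* asymptotic optimality).** Under the assumptions $A_\Sigma$, suppose that $M_{\rm goal}$ is $\xi$-regular for some $\xi>0$, that $x_{\rm init}\notin\overline{M_{\rm goal}}\setminus M_{\rm goal}$, and that there is a feasible trajectory $x^*$ of minimal cost $c^*=\ell(x^*)$ among all feasible trajectories which has weak $\delta$-clearance for some $\delta>0$. Let $\eta\ge0$ and let $c_n$ be the cost of the path returned by DPRM* with $n$ samples and the radius $$r_n=4A_{\max}(1+\eta)^{1/D}\left(\frac{\mu(M_{\rm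 free})}{D}\right)^{1/D}\left(\frac{\log n}{n}\right)^{1/D}.$$ Then for every fixed $\varepsilon>0$, as $n\to\infty$, $$\mathbb P\bigl(c_n>(1+\varepsilon)c^*\bigr)=O\bigl(n^{-\eta/D}\,\log^{-1/D}n\bigr).$$ -/

import Mathlib

open MeasureTheory Filter Topology Asymptotics

noncomputable section

namespace DPRM

/-- The ambient Euclidean space `ℝᵈ`. -/
abbrev Euc (d : ℕ) : Type := EuclideanSpace ℝ (Fin d)

/-- A driftless control-affine system `ẋ = ∑ i, uᵢ gᵢ(x)`, `u ∈ U`, on a `d`-dimensional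
configuration manifold `M ⊆ ℝᵈ` (that is, on an open subset of `ℝᵈ`). -/
structure DCASystem (d m : ℕ) where
  /-- the configuration manifold -/
  M : Set (Euc d)
  /-- the control vector fields -/
  g : Fin m → Euc d → Euc d
  /-- the control set -/
  U : Set (Fin m → ℝ)
  isOpen_M : IsOpen M
  smooth_g : ∀ i, ContDiffOn ℝ ((⊤ : ℕ∞) : WithTop ℕ∞) (g i) M
  isClosed_U : IsClosed U
  isBounded_U : Bornology.IsBounded U
  symm_U : ∀ u ∈ U, -u ∈ U
  zero_mem : (0 : Fin m → ℝ) ∈ interior (convexHull ℝ U)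

variable {d m : ℕ}

/-- A dynamically feasible trajectory `x : [0,T] → M`, with a measurable control `u : [0,T] → U`
generating it (the differential equation is written in its integral form). -/
structure Trajectory (S : DCASystem d m) where
  T : ℝ
  T_nonneg : 0 ≤ T
  x : ℝ → Euc d
  u : ℝ → Fin m → ℝ
  continuousOn_x : ContinuousOn x (Set.Icc 0 T)
  x_mem : ∀ t ∈ Set.Icc 0 T, x t ∈ S.M
  measurable_u : Measurable u
  u_mem : ∀ t ∈ Set.Icc 0 T, u t ∈ S.U
  ode : ∀ t ∈ Set.Icc 0 T, x t = x 0 + ∫ s in (0 : ℝ)..t, ∑ i, u s i • S.g i (x s)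

namespace Trajectory

variable {S : DCASystem d m}

/-- The velocity `ẋ(t) = ∑ i, uᵢ(t) gᵢ(x(t))`. -/
def velocity (τ : Trajectory S) (t : ℝ) : Euc d := ∑ i, τ.u t i • S.g i (τ.x t)

/-- The arc length `ℓ(x) = ∫₀ᵀ ‖ẋ(t)‖ dt`. -/
def length (τ : Trajectory S) : ℝ := ∫ t in (0 : ℝ)..τ.T, ‖τ.velocity t‖

/-- The trajectory leads from `p` to `q`. -/
def Joins (τ : Trajectory S) (p q : Euc d) : Prop := τ.x 0 = p ∧ τ.x τ.T = q

end Trajectory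

namespace DCASystem

/-- The sub-Riemannian distance, `∞` if no trajectory connects the points. -/
def sdist (S : DCASystem d m) (p q : Euc d) : ENNReal :=
  ⨅ (τ : Trajectory S) (_ : τ.Joins p q), ENNReal.ofReal τ.length

/-- The flag of distributions: `ℒ¹ = span (g₁,…,gₘ)`, `ℒᵏ⁺¹ = ℒᵏ + [ℒ¹, ℒᵏ]` (and `ℒ⁰ = 0`). -/
def lieFlag (S : DCASystem d m) : ℕ → Submodule ℝ (Euc d → Euc d)
  | 0 => ⊥
  | 1 => Submodule.span ℝ (Set.range S.g)
  | (k + 2) => S.lieFlag (k + 1) ⊔ Submodule.span ℝ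
      {W | ∃ Y ∈ Submodule.span ℝ (Set.range S.g), ∃ Z ∈ S.lieFlag (k + 1),
        W = VectorField.lieBracket ℝ Y Z}

/-- The subspace `Lᵏ(x)` of the tangent space at `x`. -/
def flagAt (S : DCASystem d m) (k : ℕ) (x : Euc d) : Submodule ℝ (Euc d) :=
  (S.lieFlag k).map (LinearMap.proj x)

/-- The growth vector, `n_k(x) = dim Lᵏ(x)`. -/
def growth (S : DCASystem d m) (k : ℕ) (x : Euc d) : ℕ := Module.finrank ℝ (S.flagAt k x)

/-- The weight `wᵢ` at `x` (with `i` counted from `0`): the least `k` with `i < n_k(x)`. This is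
the least `k` with `Yᵢ ∈ Lᵏ(x)` for a basis `Y₀, Y₁, …` adapted to the flag at `x`. -/
def weight (S : DCASystem d m) (x : Euc d) (i : Fin d) : ℕ := sInf {k | (i : ℕ) < S.growth k x}

/-- `s(x)`: the least `k` with `Lᵏ(x) = T_x M`. -/
def degree (S : DCASystem d m) (x : Euc d) : ℕ := sInf {k | S.flagAt k x = ⊤}

/-- `D = ∑ wᵢ`, the homogeneous dimension at `x`. When all points are regular it is locally
constant, hence independent of `x` if `M` is connected. -/
def homDim (S : DCASystem d m) (x : Euc d) : ℕ := ∑ i, S.weight x i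

/-- Iterated derivative `g_{i₁} (g_{i₂} (⋯ f))` of a function along a word in the vector fields. -/
def wordDeriv (S : DCASystem d m) (f : Euc d → ℝ) : List (Fin m) → Euc d → ℝ
  | [] => f
  | i :: l => fun x => fderiv ℝ (S.wordDeriv f l) x (S.g i x)

end DCASystem

/-- A system of privileged coordinates at `x₀`: linear coordinates `y` with respect to an orthonormal
basis of `T_{x₀} M` adapted to the flag, followed by a triangular polynomial change of coordinates
`zᵢ = yᵢ + polyᵢ(y₁,…,yᵢ₋₁)` with terms of degree `≥ 2` and `< wᵢ` only, such that `zᵢ` vanishes to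
nonholonomic order `wᵢ` at `x₀`. -/
structure PrivilegedCoords (S : DCASystem d m) (x₀ : Euc d) where
  frame : OrthonormalBasis (Fin d) ℝ (Euc d)
  adapted : ∀ k, Submodule.span ℝ (frame '' {i | (i : ℕ) < S.growth k x₀}) = S.flagAt k x₀
  poly : Fin d → MvPolynomial (Fin d) ℝ
  triangular : ∀ i, ∀ α ∈ (poly i).support, ∀ j, i ≤ j → α j = 0
  poly_degree : ∀ i, ∀ α ∈ (poly i).support, 2 ≤ α.degree ∧ α.degree < S.weight x₀ i
  order : ∀ i, ∀ l : List (Fin m), l.length < S.weight x₀ i →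
    S.wordDeriv (fun x => inner ℝ (frame i) (x - x₀) +
      MvPolynomial.eval (fun j => inner ℝ (frame j) (x - x₀)) (poly i)) l x₀ = 0

namespace PrivilegedCoords

variable {S : DCASystem d m} {x₀ : Euc d}

/-- The linear coordinates `y`. -/
def y (c : PrivilegedCoords S x₀) (x : Euc d) (i : Fin d) : ℝ := inner ℝ (c.frame i) (x - x₀)

/-- The privileged coordinates `z`. -/
def z (c : PrivilegedCoords S x₀) (x : Euc d) (i : Fin d) : ℝ :=
  c.y x i + MvPolynomial.eval (c.y x) (c.poly i)

/-- The pseudonorm `‖z(x)‖_{x₀} = maxᵢ |zᵢ(x)|^{1/wᵢ}`. -/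
def pseudonorm (c : PrivilegedCoords S x₀) (x : Euc d) : ℝ :=
  ⨆ i, |c.z x i| ^ (1 / (S.weight x₀ i : ℝ))

end PrivilegedCoords

/-- A choice of privileged coordinates at every point of the configuration manifold. -/
abbrev CoordSystem (S : DCASystem d m) : Type := ∀ p : S.M, PrivilegedCoords S (p : Euc d)

/-- The assumptions `A_Σ` on the system, with the constants occurring in them: bracket generation,
regularity of all points, the uniform ball-box inequality, the uniform distance comparison. -/
structure SystemAssumptions (S : DCASystem d m) (Z : CoordSystem S)
    (aMin aMax σMin θMin : ℝ) : Prop where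
  bracketGenerating : ∀ x ∈ S.M, ⨆ k, S.flagAt k x = ⊤
  regular : ∀ x ∈ S.M, ∀ᶠ y in 𝓝 x, ∀ k, S.growth k y = S.growth k x
  aMin_pos : 0 < aMin
  aMin_le : aMin ≤ aMax
  σMin_pos : 0 < σMin
  θMin_pos : 0 < θMin
  ballBox : ∀ x₀ : S.M, ∀ x ∈ S.M, S.sdist x₀ x < ENNReal.ofReal σMin →
    ENNReal.ofReal (aMin * (Z x₀).pseudonorm x) ≤ S.sdist x₀ x ∧
      S.sdist x₀ x ≤ ENNReal.ofReal (aMax * (Z x₀).pseudonorm x)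
  distComparison : ∀ x₀ ∈ S.M, ∀ x ∈ S.M, ‖x₀ - x‖ ≤ θMin →
    ENNReal.ofReal ‖x₀ - x‖ ≤ S.sdist x₀ x ∧
      S.sdist x₀ x ≤ ENNReal.ofReal (2 * aMax * ‖x₀ - x‖ ^ (1 / (S.degree x₀ : ℝ)))

/-- A trajectory planning problem for the system `S`. -/
structure PlanningProblem (S : DCASystem d m) where
  /-- the obstacle region -/
  obs : Set (Euc d)
  /-- the initial configuration -/
  init : Euc d
  /-- the goal region -/
  goal : Set (Euc d)
  obs_subset : obs ⊆ S.M
  isOpen_diff : IsOpen (S.M \ obs)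
  init_mem : init ∈ closure (S.M \ obs) ∩ S.M
  goal_subset : goal ⊆ closure (S.M \ obs) ∩ S.M
  goal_open : ∃ O, IsOpen O ∧ goal = O ∩ (closure (S.M \ obs) ∩ S.M)

namespace PlanningProblem

variable {S : DCASystem d m}

/-- The obstacle-free space: the closure of `M \ M_obs` in `M`. -/
def free (P : PlanningProblem S) : Set (Euc d) := closure (S.M \ P.obs) ∩ S.M

/-- Collision-free trajectories. -/
def IsCollisionFree (P : PlanningProblem S) (τ : Trajectory S) : Prop :=
  ∀ t ∈ Set.Icc 0 τ.T, τ.x t ∈ P.free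

/-- Feasible trajectories of the planning problem. -/
def IsFeasible (P : PlanningProblem S) (τ : Trajectory S) : Prop :=
  P.IsCollisionFree τ ∧ τ.x 0 = P.init ∧ τ.x τ.T ∈ closure P.goal

/-- Feasible trajectories of minimal cost. -/
def IsOptimal (P : PlanningProblem S) (τ : Trajectory S) : Prop :=
  P.IsFeasible τ ∧ ∀ τ', P.IsFeasible τ' → τ.length ≤ τ'.length

/-- Strong `δ`-clearance: the collision-free path lies in the `δ`-interior of the free space. -/
def StrongClearance (P : PlanningProblem S) (δ : ℝ) (τ : Trajectory S) : Prop :=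
  P.IsCollisionFree τ ∧ ∀ t ∈ Set.Icc 0 τ.T, ∀ a ∈ P.obs, δ ≤ dist (τ.x t) a

/-- Weak `δ`-clearance. The homotopy `ψ` has fixed endpoints, and paths of different durations are
compared after rescaling time linearly to `[0,1]`. -/
def WeakClearance (P : PlanningProblem S) (δ : ℝ) (τ : Trajectory S) : Prop :=
  P.IsCollisionFree τ ∧ ∃ ψ : ℝ → Trajectory S,
    ψ 0 = τ ∧ P.StrongClearance δ (ψ 1) ∧
    ContinuousOn (fun q : ℝ × ℝ => (ψ q.1).x (q.2 * (ψ q.1).T))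
      (Set.Icc 0 1 ×ˢ Set.Icc 0 1) ∧
    (∀ α ∈ Set.Icc (0 : ℝ) 1, (ψ α).Joins (τ.x 0) (τ.x τ.T)) ∧
    Tendsto (fun α => (ψ α).length) (𝓝[>] 0) (𝓝 τ.length) ∧
    ∀ α ∈ Set.Ioc (0 : ℝ) 1, ∃ δα > 0, P.StrongClearance δα (ψ α)

/-- `ξ`-regularity of the goal: every boundary point of the goal (boundary relative to `M`) lies on
the boundary sphere of an open Euclidean ball of radius `ξ` contained in the goal. -/
def GoalRegular (P : PlanningProblem S) (ξ : ℝ) : Prop :=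
  ∀ y ∈ frontier P.goal ∩ S.M, ∃ z ∈ P.goal, Metric.ball z ξ ⊆ P.goal ∧ dist y z = ξ

end PlanningProblem

/-- A local steering procedure: `edge p q`, when it is defined, is an optimal trajectory from `p` to
`q` neglecting obstacles; it is defined at least whenever `p` and `q` are close enough to each
other, locally uniformly. -/
structure Steering (S : DCASystem d m) where
  edge : Euc d → Euc d → Option (Trajectory S)
  optimal : ∀ p q τ, edge p q = some τ →
    τ.Joins p q ∧ ∀ τ' : Trajectory S, τ'.Joins p q → τ.length ≤ τ'.length
  local_defined : ∀ o ∈ S.M, ∃ ρ > 0, ∀ p ∈ S.M ∩ Metric.ball o ρ, ∀ q ∈ S.M ∩ Metric.ball o ρ,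
    ∃ τ, edge p q = some τ

section Algorithm

variable {S : DCASystem d m}

/-- `CollisionFree(p, q)`: the edge from `p` to `q` does not intersect an obstacle. -/
def CollisionFree (P : PlanningProblem S) (E : Steering S) (p q : Euc d) : Prop :=
  ∃ τ, E.edge p q = some τ ∧ ∀ t ∈ Set.Icc 0 τ.T, τ.x t ∉ P.obs

/-- `Near(V, x, r) = {v ∈ V : ‖v‖_x < r / a_min}`. -/
def Near (Z : CoordSystem S) (aMin : ℝ) (V : Set (Euc d)) (x : Euc d) (r : ℝ) : Set (Euc d) :=
  {v | v ∈ V ∧ ∃ hx : x ∈ S.M, (Z ⟨x, hx⟩).pseudonorm v < r / aMin}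

/-- The roadmap built by DPRM* on the vertex set `V` with radius `r`: the undirected edges `{u, v}`
with `v ∈ V`, `u ∈ Near(V \ {v}, v, r)` and `CollisionFree(u, v)`. -/
def roadmap (P : PlanningProblem S) (Z : CoordSystem S) (E : Steering S) (aMin : ℝ)
    (V : Set (Euc d)) (r : ℝ) : SimpleGraph (Euc d) :=
  SimpleGraph.fromRel fun v u => v ∈ V ∧ u ∈ Near Z aMin (V \ {v}) v r ∧ CollisionFree P E u v

/-- The cost of a path in a graph whose edges are optimal trajectories: the sum of the
sub-Riemannian lengths of its edges. -/
def walkCost (S : DCASystem d m) {G : SimpleGraph (Euc d)} {p q : Euc d} (w : G.Walk p q) :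
    ENNReal :=
  (w.darts.map fun e => S.sdist e.fst e.snd).sum

/-- `Cost(v, G)`: the cost of the shortest path in `G` from the initial state to `v`
(`∞` if there is none). -/
def graphCost (P : PlanningProblem S) (G : SimpleGraph (Euc d)) (v : Euc d) : ENNReal :=
  ⨅ w : G.Walk P.init v, walkCost S w

/-- The vertex set `{x_init} ∪ {ω₀, …, ωₙ₋₁}`. -/
def vertices (P : PlanningProblem S) {n : ℕ} (ω : Fin n → Euc d) : Set (Euc d) :=
  insert P.init (Set.range ω)

/-- The cost of the path returned by DPRM* with samples `ω` and radius `r`: the minimum of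
`Cost(v, G)` over the vertices `v` in the goal region, `∞` if the algorithm reports failure. -/
def dprmCost (P : PlanningProblem S) (Z : CoordSystem S) (E : Steering S) (aMin r : ℝ)
    {n : ℕ} (ω : Fin n → Euc d) : ENNReal :=
  ⨅ v ∈ vertices P ω ∩ P.goal, graphCost P (roadmap P Z E aMin (vertices P ω) r) v

/-- The law of `SampleFree(n)`: `n` independent uniformly distributed points of the free space. -/
def sampleFree (P : PlanningProblem S) (n : ℕ) : Measure (Fin n → Euc d) :=
  Measure.pi fun _ => ProbabilityTheory.cond (volume : Measure (Euc d)) P.free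

/-- The connection radius `rₙ`, where `D` is the homogeneous dimension. -/
def radius (P : PlanningProblem S) (aMax η : ℝ) (n : ℕ) : ℝ :=
  4 * aMax * (1 + η) ^ (1 / (S.homDim P.init : ℝ)) *
    ((volume P.free).toReal / S.homDim P.init) ^ (1 / (S.homDim P.init : ℝ)) *
    (Real.log n / n) ^ (1 / (S.homDim P.init : ℝ))

end Algorithm

end DPRM

end

/-!
Weak clearance provides a trajectory `γ` from the initial point into the goal that avoids the
obstacles and is shorter than the cost threshold `c`: take a path of the homotopy close to the given
trajectory and prolong it by a short piece. Place points along `γ` at sub-Riemannian distance about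
`r / 2` from each other, `O(1 / r)` of them. If every ball of radius `r / 4` about these points
contains a sample, then consecutive samples are less than `r` apart, so by the lower ball-box
estimate they are joined in the roadmap, and the roadmap contains a path into the goal. If moreover
all but a small proportion of the smaller balls of radius `β r` contain a sample, then choosing
samples in them wherever possible makes the cost of this path at most `c`.

By the upper ball-box estimate a ball of radius `ρ` contains the coordinate box of size `ρ / aMax`,
whose volume is at least `(ρ / aMax) ^ D`. For the radius of the theorem, `n` samples therefore miss
a given ball of radius `r / 4` with probability at most `n ^ (-(1 + η) / D)`, and the union bound
over the `O(1 / r)` balls yields the rate of the theorem. Missing a fixed proportion of the small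
balls is far less likely: every other ball of the chain is disjoint from the rest, so that the
probability of missing a prescribed set of `q` of them decays exponentially in `q`.
-/

namespace DPRM

open Set

section Splice

variable {α : Type*} {f g : ℝ → α} {T t : ℝ}

/-- The path that follows `f` up to time `T` and `g`, started at time `T`, from then on. At time `T`
itself the value is that of `f`, so the path is continuous at `T` only if `f T = g 0`. -/
noncomputable def splice (T : ℝ) (f g : ℝ → α) (t : ℝ) : α := if t ≤ T then f t else g (t - T)

theorem splice_of_le (ht : t ≤ T) : splice T f g t = f t := if_pos ht

theorem splice_of_lt (ht : T < t) : splice T f g t = g (t - T) := if_neg ht.not_ge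

theorem splice_of_ge (h : f T = g 0) (ht : T ≤ t) : splice T f g t = g (t - T) := by
  rcases ht.eq_or_lt with rfl | ht
  · rw [splice_of_le le_rfl, sub_self, h]
  · exact splice_of_lt ht

theorem splice_mem {s : Set α} {T' : ℝ} (hf : ∀ t ∈ Icc 0 T, f t ∈ s) (hg : ∀ t ∈ Icc 0 T', g t ∈ s)
    (ht : t ∈ Icc 0 (T + T')) : splice T f g t ∈ s := by
  rcases le_or_gt t T with h | h
  · exact splice_of_le (g := g) h ▸ hf t ⟨ht.1, h⟩
  · exact splice_of_lt (f := f) h ▸ hg _ ⟨sub_nonneg.2 h.le, sub_le_iff_le_add'.2 ht.2⟩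

theorem continuousOn_splice [TopologicalSpace α] {T' : ℝ} (hf : ContinuousOn f (Icc 0 T))
    (hg : ContinuousOn g (Icc 0 T')) (h : f T = g 0) :
    ContinuousOn (splice T f g) (Icc 0 (T + T')) := by
  have h₁ : ContinuousOn (splice T f g) (Icc 0 T) := hf.congr fun t ht => splice_of_le ht.2
  have h₂ : ContinuousOn (splice T f g) (Icc T (T + T')) := by
    refine ContinuousOn.congr (f := fun t => g (t - T)) (hg.comp (by fun_prop) fun t ht => ?_)
      fun t ht => splice_of_ge h ht.1
    exact ⟨sub_nonneg.2 ht.1, sub_le_iff_le_add'.2 ht.2⟩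
  exact (h₁.union_of_isClosed h₂ isClosed_Icc isClosed_Icc).mono Icc_subset_Icc_union_Icc

theorem measurable_splice [MeasurableSpace α] (hf : Measurable f) (hg : Measurable g) :
    Measurable (splice T f g) :=
  hf.ite measurableSet_Iic (hg.comp (measurable_id.sub_const T))

end Splice

section SpliceIntegral

variable {F : Type*} [NormedAddCommGroup F] [NormedSpace ℝ F] {f g : ℝ → F} {T t : ℝ}

theorem integral_splice_of_le (h0 : 0 ≤ t) (ht : t ≤ T) :
    ∫ s in (0 : ℝ)..t, splice T f g s = ∫ s in (0 : ℝ)..t, f s :=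
  intervalIntegral.integral_congr_Ioo_of_le h0 fun _ hs => splice_of_le (hs.2.le.trans ht)

theorem integral_splice (hT : 0 ≤ T) (ht : T ≤ t) (hf : IntervalIntegrable f volume 0 T)
    (hg : IntervalIntegrable g volume 0 (t - T)) :
    ∫ s in (0 : ℝ)..t, splice T f g s =
      (∫ s in (0 : ℝ)..T, f s) + ∫ s in (0 : ℝ)..(t - T), g s := by
  have hright : ∀ s ∈ uIoc T t, g (s - T) = splice T f g s := fun s hs =>
    (splice_of_lt (uIoc_of_le ht ▸ hs).1).symm
  have hfi : IntervalIntegrable (splice T f g) volume 0 T :=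
    hf.congr fun s hs => (splice_of_le (uIoc_of_le hT ▸ hs).2).symm
  have hgi : IntervalIntegrable (splice T f g) volume T t := by
    have := hg.comp_sub_right T
    rw [zero_add, sub_add_cancel] at this
    exact this.congr hright
  rw [← intervalIntegral.integral_add_adjacent_intervals hfi hgi, integral_splice_of_le hT le_rfl,
    ← sub_self T, ← intervalIntegral.integral_comp_sub_right, sub_self]
  congr 1
  exact intervalIntegral.integral_congr_ae (Eventually.of_forall fun s hs => (hright s hs).symm)

end SpliceIntegral

variable {d m : ℕ} {S : DCASystem d m}

namespace Trajectory

theorem integrableOn_velocity (τ : Trajectory S) : IntegrableOn τ.velocity (Icc 0 τ.T) := by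
  obtain ⟨C, hC⟩ := S.isBounded_U.exists_norm_le
  refine integrable_finsetSum _ fun i _ => ?_
  have hg : ContinuousOn (fun s => S.g i (τ.x s)) (Icc 0 τ.T) :=
    (S.smooth_g i).continuousOn.comp τ.continuousOn_x τ.x_mem
  have hu : ∀ᵐ s ∂volume.restrict (Icc 0 τ.T), ‖τ.u s i‖ ≤ C :=
    (ae_restrict_iff' measurableSet_Icc).2 <| Eventually.of_forall fun s hs =>
      (norm_le_pi_norm (τ.u s) i).trans (hC _ (τ.u_mem s hs))
  exact Integrable.bdd_smul hg.integrableOn_Icc C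
    ((measurable_pi_apply i).comp τ.measurable_u).aestronglyMeasurable hu

theorem intervalIntegrable_velocity (τ : Trajectory S) {a b : ℝ} (ha : a ∈ Icc 0 τ.T)
    (hb : b ∈ Icc 0 τ.T) : IntervalIntegrable τ.velocity volume a b :=
  (τ.integrableOn_velocity.mono_set (uIcc_subset_Icc ha hb)).intervalIntegrable

theorem integral_velocity (τ : Trajectory S) {a b : ℝ} (ha : a ∈ Icc 0 τ.T) (hb : b ∈ Icc 0 τ.T) :
    ∫ s in a..b, τ.velocity s = τ.x b - τ.x a := by
  have h0 : (0 : ℝ) ∈ Icc 0 τ.T := left_mem_Icc.2 τ.T_nonneg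
  rw [τ.ode a ha, τ.ode b hb, add_sub_add_left_eq_sub]
  exact (intervalIntegral.integral_interval_sub_left (τ.intervalIntegrable_velocity h0 hb)
    (τ.intervalIntegrable_velocity h0 ha)).symm

theorem length_nonneg (τ : Trajectory S) : 0 ≤ τ.length :=
  intervalIntegral.integral_nonneg τ.T_nonneg fun _ _ => norm_nonneg _

/-- The length of the part of a trajectory before the time `t`. -/
noncomputable def arcLength (τ : Trajectory S) (t : ℝ) : ℝ := ∫ s in (0 : ℝ)..t, ‖τ.velocity s‖

theorem arcLength_sub (τ : Trajectory S) {a b : ℝ} (ha : a ∈ Icc 0 τ.T) (hb : b ∈ Icc 0 τ.T) :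
    τ.arcLength b - τ.arcLength a = ∫ s in a..b, ‖τ.velocity s‖ :=
  have h0 : (0 : ℝ) ∈ Icc 0 τ.T := left_mem_Icc.2 τ.T_nonneg
  intervalIntegral.integral_interval_sub_left (τ.intervalIntegrable_velocity h0 hb).norm
    (τ.intervalIntegrable_velocity h0 ha).norm

theorem continuousOn_arcLength (τ : Trajectory S) : ContinuousOn τ.arcLength (Icc 0 τ.T) := by
  have h : IntegrableOn (fun t => ‖τ.velocity t‖) (uIcc 0 τ.T) :=
    uIcc_of_le τ.T_nonneg ▸ τ.integrableOn_velocity.norm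
  exact uIcc_of_le τ.T_nonneg ▸ intervalIntegral.continuousOn_primitive_interval h

theorem monotoneOn_arcLength (τ : Trajectory S) : MonotoneOn τ.arcLength (Icc 0 τ.T) :=
  fun _ ha _ hb hab => sub_nonneg.1 <| τ.arcLength_sub ha hb ▸
    intervalIntegral.integral_nonneg hab fun _ _ => norm_nonneg _

theorem dist_le_abs_arcLength_sub (τ : Trajectory S) {a b : ℝ} (ha : a ∈ Icc 0 τ.T)
    (hb : b ∈ Icc 0 τ.T) : dist (τ.x a) (τ.x b) ≤ |τ.arcLength b - τ.arcLength a| := by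
  rw [dist_comm, dist_eq_norm, ← τ.integral_velocity ha hb, τ.arcLength_sub ha hb]
  exact intervalIntegral.norm_integral_le_abs_integral_norm

theorem dist_start_le (τ : Trajectory S) {t : ℝ} (ht : t ∈ Icc 0 τ.T) :
    dist (τ.x 0) (τ.x t) ≤ τ.length := by
  have h0 : (0 : ℝ) ∈ Icc 0 τ.T := left_mem_Icc.2 τ.T_nonneg
  have hT : τ.T ∈ Icc 0 τ.T := right_mem_Icc.2 τ.T_nonneg
  calc dist (τ.x 0) (τ.x t) ≤ |τ.arcLength t - τ.arcLength 0| := τ.dist_le_abs_arcLength_sub h0 ht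
    _ = τ.arcLength t := by
      rw [abs_of_nonneg (sub_nonneg.2 (τ.monotoneOn_arcLength h0 ht ht.1)), arcLength, arcLength,
        intervalIntegral.integral_same, sub_zero]
    _ ≤ τ.length := τ.monotoneOn_arcLength ht hT ht.2

/-- The trajectory traversed backwards. -/
def reverse (τ : Trajectory S) : Trajectory S where
  T := τ.T
  T_nonneg := τ.T_nonneg
  x t := τ.x (τ.T - t)
  u t := -τ.u (τ.T - t)
  continuousOn_x := τ.continuousOn_x.comp (by fun_prop) fun _ ht =>
    ⟨sub_nonneg.2 ht.2, sub_le_self _ ht.1⟩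
  x_mem t ht := τ.x_mem _ ⟨sub_nonneg.2 ht.2, sub_le_self _ ht.1⟩
  measurable_u := (τ.measurable_u.comp (measurable_const.sub measurable_id)).neg
  u_mem t ht := S.symm_U _ (τ.u_mem _ ⟨sub_nonneg.2 ht.2, sub_le_self _ ht.1⟩)
  ode t ht := by
    have hv : ∀ s, ∑ i, (-τ.u (τ.T - s)) i • S.g i (τ.x (τ.T - s)) = -τ.velocity (τ.T - s) :=
      fun s => by simp only [velocity, Pi.neg_apply, neg_smul, Finset.sum_neg_distrib]
    simp only [hv, intervalIntegral.integral_neg, sub_zero]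
    rw [intervalIntegral.integral_comp_sub_left, sub_zero,
      τ.integral_velocity ⟨sub_nonneg.2 ht.2, sub_le_self _ ht.1⟩ (right_mem_Icc.2 τ.T_nonneg)]
    abel

theorem velocity_reverse (τ : Trajectory S) (t : ℝ) :
    τ.reverse.velocity t = -τ.velocity (τ.T - t) := by
  simp only [velocity, reverse, Pi.neg_apply, neg_smul, Finset.sum_neg_distrib]

theorem length_reverse (τ : Trajectory S) : τ.reverse.length = τ.length := by
  simp only [length, velocity_reverse, norm_neg]
  change ∫ t in (0 : ℝ)..τ.T, ‖τ.velocity (τ.T - t)‖ = _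
  rw [intervalIntegral.integral_comp_sub_left (fun t => ‖τ.velocity t‖), sub_self, sub_zero]

theorem Joins.reverse {τ : Trajectory S} {p q : Euc d} (h : τ.Joins p q) : τ.reverse.Joins q p :=
  ⟨by simpa only [Trajectory.reverse, sub_zero] using h.2,
    by simpa only [Trajectory.reverse, sub_self] using h.1⟩

/-- The part of a trajectory between the times `a` and `b`. -/
def restrict (τ : Trajectory S) (a b : ℝ) (ha : 0 ≤ a) (hab : a ≤ b) (hb : b ≤ τ.T) :
    Trajectory S where
  T := b - a
  T_nonneg := sub_nonneg.2 hab
  x t := τ.x (a + t)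
  u t := τ.u (a + t)
  continuousOn_x := τ.continuousOn_x.comp (by fun_prop) fun t ht =>
    ⟨add_nonneg ha ht.1, by linarith [ht.2]⟩
  x_mem t ht := τ.x_mem _ ⟨add_nonneg ha ht.1, by linarith [ht.2]⟩
  measurable_u := τ.measurable_u.comp (measurable_const.add measurable_id)
  u_mem t ht := τ.u_mem _ ⟨add_nonneg ha ht.1, by linarith [ht.2]⟩
  ode t ht := by
    change _ = _ + ∫ s in (0 : ℝ)..t, τ.velocity (a + s)
    rw [intervalIntegral.integral_comp_add_left, add_zero,
      τ.integral_velocity ⟨ha, hab.trans hb⟩ ⟨add_nonneg ha ht.1, by linarith [ht.2]⟩]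
    abel

theorem length_restrict (τ : Trajectory S) {a b : ℝ} (ha : 0 ≤ a) (hab : a ≤ b) (hb : b ≤ τ.T) :
    (τ.restrict a b ha hab hb).length = τ.arcLength b - τ.arcLength a := by
  rw [τ.arcLength_sub ⟨ha, hab.trans hb⟩ ⟨ha.trans hab, hb⟩]
  change ∫ t in (0 : ℝ)..(b - a), ‖τ.velocity (a + t)‖ = _
  rw [intervalIntegral.integral_comp_add_left (fun t => ‖τ.velocity t‖), add_zero,
    add_sub_cancel]

theorem sum_splice_smul (τ₁ τ₂ : Trajectory S) (t : ℝ) :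
    ∑ i, splice τ₁.T τ₁.u τ₂.u t i • S.g i (splice τ₁.T τ₁.x τ₂.x t) =
      splice τ₁.T τ₁.velocity τ₂.velocity t := by
  unfold splice
  split_ifs <;> rfl

/-- The concatenation of two trajectories. -/
noncomputable def concat (τ₁ τ₂ : Trajectory S) (h : τ₁.x τ₁.T = τ₂.x 0) : Trajectory S where
  T := τ₁.T + τ₂.T
  T_nonneg := add_nonneg τ₁.T_nonneg τ₂.T_nonneg
  x := splice τ₁.T τ₁.x τ₂.x
  u := splice τ₁.T τ₁.u τ₂.u
  continuousOn_x := continuousOn_splice τ₁.continuousOn_x τ₂.continuousOn_x h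
  x_mem _ := splice_mem τ₁.x_mem τ₂.x_mem
  measurable_u := measurable_splice τ₁.measurable_u τ₂.measurable_u
  u_mem _ := splice_mem τ₁.u_mem τ₂.u_mem
  ode t ht := by
    have h1 : τ₁.T ∈ Icc 0 τ₁.T := right_mem_Icc.2 τ₁.T_nonneg
    have h01 : (0 : ℝ) ∈ Icc 0 τ₁.T := left_mem_Icc.2 τ₁.T_nonneg
    have h02 : (0 : ℝ) ∈ Icc 0 τ₂.T := left_mem_Icc.2 τ₂.T_nonneg
    simp only [sum_splice_smul]
    rw [splice_of_le τ₁.T_nonneg]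
    rcases le_total t τ₁.T with ht' | ht'
    · rw [integral_splice_of_le ht.1 ht', splice_of_le ht']
      exact τ₁.ode t ⟨ht.1, ht'⟩
    · have h2 : t - τ₁.T ∈ Icc 0 τ₂.T := ⟨sub_nonneg.2 ht', sub_le_iff_le_add'.2 ht.2⟩
      rw [integral_splice τ₁.T_nonneg ht' (τ₁.intervalIntegrable_velocity h01 h1)
        (τ₂.intervalIntegrable_velocity h02 h2), splice_of_ge h ht', τ₁.integral_velocity h01 h1,
        τ₂.integral_velocity h02 h2, h]
      abel

theorem length_concat {τ₁ τ₂ : Trajectory S} (h : τ₁.x τ₁.T = τ₂.x 0) :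
    (concat τ₁ τ₂ h).length = τ₁.length + τ₂.length := by
  have hnorm : ∀ t, ‖(concat τ₁ τ₂ h).velocity t‖ =
      splice τ₁.T (fun t => ‖τ₁.velocity t‖) (fun t => ‖τ₂.velocity t‖) t := fun t => by
    rw [show (concat τ₁ τ₂ h).velocity t = splice τ₁.T τ₁.velocity τ₂.velocity t from
      sum_splice_smul τ₁ τ₂ t]
    unfold splice
    split_ifs <;> rfl
  have hT : τ₁.T + τ₂.T - τ₁.T = τ₂.T := add_sub_cancel_left τ₁.T τ₂.T
  have hint : ∀ τ : Trajectory S, IntervalIntegrable (fun t => ‖τ.velocity t‖) volume 0 τ.T :=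
    fun τ => (τ.intervalIntegrable_velocity (left_mem_Icc.2 τ.T_nonneg)
      (right_mem_Icc.2 τ.T_nonneg)).norm
  simp only [length, hnorm]
  change ∫ t in (0 : ℝ)..(τ₁.T + τ₂.T), _ = _
  rw [integral_splice τ₁.T_nonneg (le_add_of_nonneg_right τ₂.T_nonneg) (hint τ₁)
    (hT.symm ▸ hint τ₂), hT]

theorem joins_concat {τ₁ τ₂ : Trajectory S} (h : τ₁.x τ₁.T = τ₂.x 0) :
    (concat τ₁ τ₂ h).Joins (τ₁.x 0) (τ₂.x τ₂.T) := by
  refine ⟨splice_of_le τ₁.T_nonneg, ?_⟩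
  change splice τ₁.T τ₁.x τ₂.x (τ₁.T + τ₂.T) = τ₂.x τ₂.T
  rw [splice_of_ge h (le_add_of_nonneg_right τ₂.T_nonneg), add_sub_cancel_left]

end Trajectory

namespace DCASystem

theorem sdist_le_of_joins {τ : Trajectory S} {p q : Euc d} (h : τ.Joins p q) :
    S.sdist p q ≤ ENNReal.ofReal τ.length :=
  iInf₂_le τ h

theorem exists_joins_of_sdist_lt {p q : Euc d} {c : ℝ} (h : S.sdist p q < ENNReal.ofReal c) :
    ∃ τ : Trajectory S, τ.Joins p q ∧ τ.length < c := by
  simp only [sdist, iInf_lt_iff] at h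
  obtain ⟨τ, hτ, hlt⟩ := h
  exact ⟨τ, hτ, (ENNReal.ofReal_lt_ofReal_iff_of_nonneg τ.length_nonneg).1 hlt⟩

theorem ofReal_dist_le_sdist (p q : Euc d) : ENNReal.ofReal (dist p q) ≤ S.sdist p q := by
  refine le_iInf₂ fun τ h => ENNReal.ofReal_le_ofReal ?_
  rw [← h.1, ← h.2]
  exact τ.dist_start_le (right_mem_Icc.2 τ.T_nonneg)

theorem dist_lt_of_sdist_lt {p q : Euc d} {c : ℝ} (h : S.sdist p q < ENNReal.ofReal c) :
    dist p q < c :=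
  (ENNReal.ofReal_lt_ofReal_iff_of_nonneg dist_nonneg).1 ((ofReal_dist_le_sdist p q).trans_lt h)

variable (S)

theorem nonempty_U : S.U.Nonempty :=
  convexHull_nonempty_iff.1 ⟨0, interior_subset S.zero_mem⟩

variable {S}

theorem sdist_self {p : Euc d} (hp : p ∈ S.M) : S.sdist p p = 0 := by
  obtain ⟨u, hu⟩ := S.nonempty_U
  let τ : Trajectory S :=
    { T := 0
      T_nonneg := le_rfl
      x := fun _ => p
      u := fun _ => u
      continuousOn_x := continuousOn_const
      x_mem := fun _ _ => hp
      measurable_u := measurable_const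
      u_mem := fun _ _ => hu
      ode := fun t ht => by
        rw [le_antisymm ht.2 ht.1, intervalIntegral.integral_same, add_zero] }
  have hτ : τ.length = 0 := intervalIntegral.integral_same
  simpa only [hτ, ENNReal.ofReal_zero, nonpos_iff_eq_zero] using
    sdist_le_of_joins (τ := τ) ⟨rfl, rfl⟩

theorem sdist_comm (p q : Euc d) : S.sdist p q = S.sdist q p := by
  have hle : ∀ p q, S.sdist p q ≤ S.sdist q p := fun p q =>
    le_iInf₂ fun τ h => τ.length_reverse ▸ sdist_le_of_joins h.reverse
  exact le_antisymm (hle p q) (hle q p)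

theorem sdist_triangle (p q r : Euc d) : S.sdist p r ≤ S.sdist p q + S.sdist q r := by
  refine ENNReal.le_iInf₂_add_iInf₂ fun τ₁ h₁ τ₂ h₂ => ?_
  have h : τ₁.x τ₁.T = τ₂.x 0 := h₁.2.trans h₂.1.symm
  rw [← ENNReal.ofReal_add τ₁.length_nonneg τ₂.length_nonneg, ← Trajectory.length_concat h,
    ← h₁.1, ← h₂.2]
  exact sdist_le_of_joins (Trajectory.joins_concat h)

/-- The open ball of radius `ρ` about `p` for the sub-Riemannian distance. -/
def sball (S : DCASystem d m) (p : Euc d) (ρ : ℝ) : Set (Euc d) :=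
  {x | S.sdist p x < ENNReal.ofReal ρ}

theorem mem_sball_self {p : Euc d} {ρ : ℝ} (hp : p ∈ S.M) (hρ : 0 < ρ) : p ∈ S.sball p ρ :=
  (sdist_self hp).trans_lt (ENNReal.ofReal_pos.2 hρ)

theorem mem_sball_comm {p q : Euc d} {ρ : ℝ} : q ∈ S.sball p ρ ↔ p ∈ S.sball q ρ := by
  rw [sball, sball, mem_ofPred_eq, mem_ofPred_eq, sdist_comm]

theorem sball_subset_ball (p : Euc d) (ρ : ℝ) : S.sball p ρ ⊆ Metric.ball p ρ := fun _ hx =>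
  Metric.mem_ball'.2 (dist_lt_of_sdist_lt hx)

theorem disjoint_sball {p q : Euc d} {ρ ρ' : ℝ}
    (h : ENNReal.ofReal ρ + ENNReal.ofReal ρ' ≤ S.sdist p q) :
    Disjoint (S.sball p ρ) (S.sball q ρ') := by
  refine disjoint_left.2 fun x hp hq => h.not_gt ?_
  calc S.sdist p q ≤ S.sdist p x + S.sdist x q := sdist_triangle p x q
    _ < ENNReal.ofReal ρ + ENNReal.ofReal ρ' := ENNReal.add_lt_add hp (mem_sball_comm.1 hq)

theorem sdist_lt_of_mem_sball {p q x y : Euc d} {a b h : ℝ} (hh : 0 ≤ h) (ha : 0 ≤ a) (hb : 0 ≤ b)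
    (hpq : S.sdist p q ≤ ENNReal.ofReal h) (hx : x ∈ S.sball p a) (hy : y ∈ S.sball q b) :
    S.sdist x y < ENNReal.ofReal (a + h + b) := by
  calc S.sdist x y ≤ S.sdist x p + S.sdist p q + S.sdist q y :=
        (sdist_triangle x q y).trans (by gcongr; exact sdist_triangle x p q)
    _ < ENNReal.ofReal a + ENNReal.ofReal h + ENNReal.ofReal b :=
        ENNReal.add_lt_add (ENNReal.add_lt_add_of_lt_of_le
          (ne_top_of_le_ne_top ENNReal.ofReal_ne_top hpq) (mem_sball_comm.1 hx) hpq) hy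
    _ = ENNReal.ofReal (a + h + b) := by
        rw [ENNReal.ofReal_add (add_nonneg ha hh) hb, ENNReal.ofReal_add ha hh]

end DCASystem

open DCASystem

theorem Trajectory.sdist_le_abs_arcLength_sub (τ : Trajectory S) {a b : ℝ} (ha : a ∈ Icc 0 τ.T)
    (hb : b ∈ Icc 0 τ.T) :
    S.sdist (τ.x a) (τ.x b) ≤ ENNReal.ofReal |τ.arcLength b - τ.arcLength a| := by
  wlog hab : a ≤ b generalizing a b
  · rw [sdist_comm, abs_sub_comm]
    exact this hb ha (le_of_not_ge hab)
  rw [abs_of_nonneg (sub_nonneg.2 (τ.monotoneOn_arcLength ha hb hab)),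
    ← τ.length_restrict ha.1 hab hb.2]
  refine sdist_le_of_joins ⟨?_, ?_⟩
  · simp only [restrict, add_zero]
  · simp only [restrict, add_sub_cancel]

theorem Trajectory.exists_chain (τ : Trajectory S) {h : ℝ} (hh : 0 < h) :
    ∃ p : ℕ → Euc d, p 0 = τ.x 0 ∧ p ⌈τ.length / h⌉₊ = τ.x τ.T ∧
      (∀ k, p k ∈ τ.x '' Icc 0 τ.T) ∧ ∀ k, S.sdist (p k) (p (k + 1)) ≤ ENNReal.ofReal h := by
  have h0 : (0 : ℝ) ∈ Icc 0 τ.T := left_mem_Icc.2 τ.T_nonneg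
  have hT : τ.T ∈ Icc 0 τ.T := right_mem_Icc.2 τ.T_nonneg
  have hA0 : τ.arcLength 0 = 0 := intervalIntegral.integral_same
  have hAT : τ.arcLength τ.T = τ.length := rfl
  have hex : ∀ k : ℕ, ∃ t ∈ Icc 0 τ.T, τ.arcLength t = min (k * h) τ.length := fun k =>
    intermediate_value_Icc τ.T_nonneg τ.continuousOn_arcLength
      (by rw [hA0, hAT]; exact ⟨le_min (by positivity) τ.length_nonneg, min_le_right _ _⟩)
  choose t ht htA using hex
  have heq : ∀ {a b}, a ∈ Icc 0 τ.T → b ∈ Icc 0 τ.T → τ.arcLength a = τ.arcLength b →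
      τ.x a = τ.x b := fun ha hb hab =>
    dist_le_zero.1 ((τ.dist_le_abs_arcLength_sub ha hb).trans_eq (by rw [hab, sub_self, abs_zero]))
  refine ⟨fun k => τ.x (t k), heq (ht 0) h0 ?_, heq (ht _) hT ?_, fun k => ⟨t k, ht k, rfl⟩,
    fun k => (τ.sdist_le_abs_arcLength_sub (ht k) (ht (k + 1))).trans
      (ENNReal.ofReal_le_ofReal ?_)⟩
  · rw [htA, hA0, Nat.cast_zero, zero_mul, min_eq_left τ.length_nonneg]
  · rw [htA, hAT, min_eq_right ((div_le_iff₀ hh).1 (Nat.le_ceil _))]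
  · rw [htA, htA]
    refine (abs_min_sub_min_le_max _ _ _ _).trans (max_le (le_of_eq ?_) ?_)
    · rw [Nat.cast_add_one, add_one_mul, add_sub_cancel_left, abs_of_pos hh]
    · rw [sub_self, abs_zero]
      exact hh.le

theorem exists_minimal_chain {α : Type*} (R : α → α → Prop) (C : Set α) {N : ℕ} {p : ℕ → α}
    (hC : ∀ k, p k ∈ C) (hR : ∀ k < N, R (p k) (p (k + 1))) :
    ∃ K ≤ N, ∃ q : ℕ → α, q 0 = p 0 ∧ q K = p N ∧ (∀ k, q k ∈ C) ∧
      (∀ k < K, R (q k) (q (k + 1))) ∧ ∀ i j, i + 1 < j → j ≤ K → ¬ R (q i) (q j) := by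
  classical
  have hex : ∃ K, ∃ q : ℕ → α, q 0 = p 0 ∧ q K = p N ∧ (∀ k, q k ∈ C) ∧
      ∀ k < K, R (q k) (q (k + 1)) := ⟨N, p, rfl, rfl, hC, hR⟩
  obtain ⟨q, h0, hK, hqC, hqR⟩ := Nat.find_spec hex
  refine ⟨Nat.find hex, Nat.find_min' hex ⟨p, rfl, rfl, hC, hR⟩, q, h0, hK, hqC, hqR,
    fun i j hij hj hRij => ?_⟩
  -- The chord from `i` to `j` gives a chain that skips the `j - i - 1` vertices between them.
  refine Nat.find_min hex (m := Nat.find hex - (j - i - 1)) (by omega)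
    ⟨fun k => if k ≤ i then q k else q (k + (j - i - 1)), by simpa using h0, ?_, fun k => ?_,
      fun k hk => ?_⟩
  · beta_reduce
    rw [if_neg (by omega), Nat.sub_add_cancel (by omega), hK]
  · beta_reduce
    split_ifs <;> exact hqC _
  · beta_reduce
    rcases lt_trichotomy k i with h | rfl | h
    · rw [if_pos h.le, if_pos (by omega)]
      exact hqR k (by omega)
    · rw [if_pos le_rfl, if_neg (by omega), show k + 1 + (j - k - 1) = j by omega]
      exact hRij
    · rw [if_neg (by omega), if_neg (by omega),
        show k + 1 + (j - i - 1) = k + (j - i - 1) + 1 by omega]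
      exact hqR _ (by omega)

theorem Trajectory.exists_chordless_chain (τ : Trajectory S) {h : ℝ} (hh : 0 < h) :
    ∃ (K : ℕ) (p : ℕ → Euc d), K ≤ τ.length / h + 1 ∧ p 0 = τ.x 0 ∧ p K = τ.x τ.T ∧
      (∀ k, p k ∈ τ.x '' Icc 0 τ.T) ∧
      (∀ k < K, S.sdist (p k) (p (k + 1)) ≤ ENNReal.ofReal h) ∧
      ∀ i j, i + 1 < j → j ≤ K → ENNReal.ofReal h < S.sdist (p i) (p j) := by
  obtain ⟨p, hp0, hpN, hp, hstep⟩ := τ.exists_chain hh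
  obtain ⟨K, hK, q, hq0, hqK, hq, hqstep, hchord⟩ :=
    exists_minimal_chain (fun x y => S.sdist x y ≤ ENNReal.ofReal h) (τ.x '' Icc 0 τ.T)
      (N := ⌈τ.length / h⌉₊) hp fun k _ => hstep k
  refine ⟨K, q, ?_, hq0.trans hp0, hqK.trans hpN, hq, hqstep,
    fun i j hij hj => not_le.1 (hchord i j hij hj)⟩
  exact (Nat.cast_le.2 hK).trans (Nat.ceil_lt_add_one (div_nonneg τ.length_nonneg hh.le)).le

section Triangular

variable {ι : Type*} [DecidableEq ι]

/-- The shear `y ↦ y + f(y) eᵢ` along the `i`-th coordinate, by a function `f` that does not depend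
on that coordinate. -/
def shear (i : ι) (f : (ι → ℝ) → ℝ) (hf : Continuous f)
    (hi : ∀ y t, f (Function.update y i t) = f y) : (ι → ℝ) ≃ₜ (ι → ℝ) where
  toFun y := Function.update y i (y i + f y)
  invFun y := Function.update y i (y i - f y)
  left_inv y := by simp [hi]
  right_inv y := by simp [hi]
  continuous_toFun := continuous_id.update i ((continuous_apply i).add hf)
  continuous_invFun := continuous_id.update i ((continuous_apply i).sub hf)

theorem shear_update {i : ι} {f : (ι → ℝ) → ℝ} (hf : Continuous f)
    (hi : ∀ y t, f (Function.update y i t) = f y) (y : ι → ℝ) (t : ℝ) :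
    shear i f hf hi (Function.update y i t) = Function.update y i (t + f y) := by
  change Function.update (Function.update y i t) i _ = _
  rw [Function.update_idem, Function.update_self, hi]

theorem measurePreserving_shear [Fintype ι] (i : ι) {f : (ι → ℝ) → ℝ} (hf : Continuous f)
    (hi : ∀ y t, f (Function.update y i t) = f y) :
    MeasurePreserving (shear i f hf hi) volume volume := by
  have hm : Measurable (shear i f hf hi) := (shear i f hf hi).continuous.measurable
  refine ⟨hm, Measure.ext fun s hs => ?_⟩
  rw [Measure.map_apply hm hs, ← lintegral_indicator_one (hm hs), ← lintegral_indicator_one hs]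
  -- On each line parallel to the `i`-th axis, the shear is a translation.
  refine lintegral_eq_of_lmarginal_eq {i} (measurable_const.indicator (hm hs))
    (measurable_const.indicator hs) ?_
  rw [lmarginal_singleton, lmarginal_singleton]
  funext y
  have hline : ∀ t, ((shear i f hf hi ⁻¹' s).indicator 1 (Function.update y i t) : ENNReal) =
      (fun t => s.indicator 1 (Function.update y i t)) (t + f y) := fun t =>
    congrArg (s.indicator 1) (shear_update hf hi y t)
  simp only [hline]
  exact lintegral_add_right_eq_self (μ := (volume : Measure ℝ))
    (fun t => s.indicator 1 (Function.update y i t)) (f y)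

end Triangular

theorem exists_homeomorph_triangular {ι : Type*} [Fintype ι] [LinearOrder ι]
    {f : ι → (ι → ℝ) → ℝ} (hf : ∀ i, Continuous (f i))
    (htri : ∀ i y y', (∀ j < i, y j = y' j) → f i y = f i y') :
    ∃ e : (ι → ℝ) ≃ₜ (ι → ℝ), (∀ y i, e y i = y i + f i y) ∧
      MeasurePreserving e volume volume := by
  suffices ∀ s : Finset ι, ∃ e : (ι → ℝ) ≃ₜ (ι → ℝ),
      (∀ y i, e y i = y i + if i ∈ s then f i y else 0) ∧ MeasurePreserving e volume volume by
    simpa using this Finset.univ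
  intro s
  -- The shears are composed from the last coordinate down, so that each one is applied while the
  -- coordinates its function depends on are still unchanged.
  induction s using Finset.induction_on_min with
  | empty => exact ⟨Homeomorph.refl _, by simp, MeasurePreserving.id _⟩
  | insert i s hi ih =>
    obtain ⟨e, he, hmp⟩ := ih
    have hind : ∀ y t, f i (Function.update y i t) = f i y := fun y t =>
      htri _ _ _ fun j hj => Function.update_of_ne hj.ne _ _
    have hfe : ∀ y, f i (e y) = f i y := fun y => htri _ _ _ fun j hj => by
      rw [he, if_neg fun hjs => (hi j hjs).not_gt hj, add_zero]
    refine ⟨e.trans (shear i (f i) (hf i) hind), fun y j => ?_,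
      (measurePreserving_shear i (hf i) hind).comp hmp⟩
    change Function.update (e y) i (e y i + f i (e y)) j = _
    rcases eq_or_ne j i with rfl | hne
    · rw [Function.update_self, hfe, he, if_neg fun hjs => (hi j hjs).false, add_zero,
        if_pos (Finset.mem_insert_self j s)]
    · simp only [Function.update_of_ne hne, he, Finset.mem_insert, hne, false_or]

namespace PrivilegedCoords

variable {x₀ : Euc d}

theorem exists_homeomorph (c : PrivilegedCoords S x₀) :
    ∃ e : Euc d ≃ₜ (Fin d → ℝ), (∀ x, e x = c.z x) ∧ MeasurePreserving e volume volume := by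
  have htri : ∀ i (y y' : Fin d → ℝ), (∀ j < i, y j = y' j) →
      MvPolynomial.eval y (c.poly i) = MvPolynomial.eval y' (c.poly i) := fun i y y' h =>
    MvPolynomial.eval₂_congr _ _ _ fun {j α} hj hα => h j <| not_le.1 fun hij =>
      Finsupp.mem_support_iff.1 hj
        (c.triangular i α (MvPolynomial.mem_support_iff.2 hα) j hij)
  obtain ⟨e, he, hmp⟩ := exists_homeomorph_triangular
    (fun i => MvPolynomial.continuous_eval (c.poly i)) htri
  refine ⟨((Homeomorph.subRight x₀).trans c.frame.repr.toHomeomorph).trans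
    ((PiLp.homeomorph 2 fun _ : Fin d => ℝ).trans e), fun x => funext fun i => ?_, ?_⟩
  · have hy : (c.frame.repr (x - x₀)).ofLp = c.y x := funext fun j =>
      c.frame.repr_apply_apply _ _
    change e (c.frame.repr (x - x₀)).ofLp i = _
    rw [he, hy]
    rfl
  · exact (hmp.comp (PiLp.volume_preserving_ofLp (Fin d))).comp
      (c.frame.measurePreserving_repr.comp (measurePreserving_sub_right volume x₀))

theorem z_self (c : PrivilegedCoords S x₀) (i : Fin d) : c.z x₀ i = 0 := by
  have hy : c.y x₀ = 0 := funext fun j => by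
    simp only [y, sub_self, inner_zero_right, Pi.zero_apply]
  have h0 : (c.poly i).coeff 0 = 0 := by
    by_contra h
    simpa using (c.poly_degree i 0 (MvPolynomial.mem_support_iff.2 h)).1
  rw [z, hy, MvPolynomial.eval_zero, MvPolynomial.constantCoeff_eq, h0, Pi.zero_apply, add_zero]

/-- The anisotropic box of radius `ρ` in privileged coordinates. If no weight vanishes, it is the
open `ρ`-ball of the pseudonorm. -/
def box (c : PrivilegedCoords S x₀) (ρ : ℝ) : Set (Euc d) :=
  {x | ∀ i, |c.z x i| < ρ ^ S.weight x₀ i}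

theorem self_mem_box (c : PrivilegedCoords S x₀) {ρ : ℝ} (hρ : 0 < ρ) : x₀ ∈ c.box ρ := fun i => by
  rw [c.z_self, abs_zero]
  positivity

theorem box_eq_preimage (c : PrivilegedCoords S x₀) {e : Euc d ≃ₜ (Fin d → ℝ)}
    (he : ∀ x, e x = c.z x) (ρ : ℝ) :
    c.box ρ = e ⁻¹' univ.pi fun i => Metric.ball 0 (ρ ^ S.weight x₀ i) := by
  ext x
  simp [box, he]

theorem isPreconnected_box (c : PrivilegedCoords S x₀) (ρ : ℝ) : IsPreconnected (c.box ρ) := by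
  obtain ⟨e, he, -⟩ := c.exists_homeomorph
  rw [c.box_eq_preimage he, e.isPreconnected_preimage]
  exact (convex_pi fun i _ => convex_ball 0 _).isPreconnected

theorem volume_box (c : PrivilegedCoords S x₀) {ρ : ℝ} (hρ : 0 ≤ ρ) :
    volume (c.box ρ) = ENNReal.ofReal (2 ^ d * ρ ^ S.homDim x₀) := by
  obtain ⟨e, he, hmp⟩ := c.exists_homeomorph
  rw [c.box_eq_preimage he, hmp.measure_preimage_emb e.measurableEmbedding, volume_pi_pi]
  simp only [Real.volume_ball]
  rw [← ENNReal.ofReal_prod_of_nonneg fun i _ => by positivity, Finset.prod_mul_distrib,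
    Finset.prod_pow_eq_pow_sum, Finset.prod_const, Finset.card_fin, DCASystem.homDim]

theorem pseudonorm_lt_of_mem_box (c : PrivilegedCoords S x₀) (hw : ∀ i, S.weight x₀ i ≠ 0) {ρ : ℝ}
    (hρ : 0 < ρ) {x : Euc d} (hx : x ∈ c.box ρ) : c.pseudonorm x < ρ := by
  have hlt : ∀ i, |c.z x i| ^ (1 / (S.weight x₀ i : ℝ)) < ρ := fun i => by
    rw [one_div, Real.rpow_inv_lt_iff_of_pos (abs_nonneg _) hρ.le
      (Nat.cast_pos.2 (Nat.pos_of_ne_zero (hw i))), Real.rpow_natCast]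
    exact hx i
  rcases isEmpty_or_nonempty (Fin d) with _ | _
  · rw [pseudonorm, Real.iSup_of_isEmpty]
    exact hρ
  · obtain ⟨i, hi⟩ :=
      exists_eq_ciSup_of_finite (f := fun i => |c.z x i| ^ (1 / (S.weight x₀ i : ℝ)))
    exact hi.symm.trans_lt (hlt i)

end PrivilegedCoords

namespace DCASystem

theorem monotone_flagAt (x : Euc d) : Monotone fun k => S.flagAt k x := by
  refine monotone_nat_of_le_succ fun k => Submodule.map_mono ?_
  cases k with
  | zero => exact bot_le
  | succ k => exact le_sup_left

theorem growth_zero (x : Euc d) : S.growth 0 x = 0 := by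
  rw [growth, flagAt, lieFlag, Submodule.map_bot, finrank_bot]

theorem growth_eq_of_flagAt_eq_top {x : Euc d} {k : ℕ} (h : S.flagAt k x = ⊤) :
    S.growth k x = d := by
  rw [growth, h, finrank_top, finrank_euclideanSpace_fin]

theorem exists_flagAt_eq_top {x : Euc d} (hx : ⨆ k, S.flagAt k x = ⊤) : ∃ k, S.flagAt k x = ⊤ :=
  ⟨_, (WellFoundedGT.iSup_eq_monotonicSequenceLimit
    ⟨fun k => S.flagAt k x, monotone_flagAt x⟩).symm.trans hx⟩

theorem weight_ne_zero {x : Euc d} (hx : ⨆ k, S.flagAt k x = ⊤) (i : Fin d) :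
    S.weight x i ≠ 0 := fun h => by
  obtain ⟨k, hk⟩ := exists_flagAt_eq_top hx
  have hmem : (i : ℕ) < S.growth (S.weight x i) x :=
    Nat.sInf_mem (s := {k | (i : ℕ) < S.growth k x})
      ⟨k, i.2.trans_eq (growth_eq_of_flagAt_eq_top hk).symm⟩
  exact Nat.not_lt_zero _ (growth_zero (S := S) x ▸ h ▸ hmem)

theorem homDim_pos [NeZero d] {x : Euc d} (hx : ⨆ k, S.flagAt k x = ⊤) : 0 < S.homDim x :=
  Finset.sum_pos (fun i _ => Nat.pos_of_ne_zero (weight_ne_zero hx i)) Finset.univ_nonempty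

theorem degree_ne_zero [NeZero d] {x : Euc d} (hx : ⨆ k, S.flagAt k x = ⊤) :
    S.degree x ≠ 0 := fun h => by
  have htop : S.flagAt (S.degree x) x = ⊤ := Nat.sInf_mem (exists_flagAt_eq_top hx)
  have hd := growth_eq_of_flagAt_eq_top htop
  rw [h, growth_zero] at hd
  exact NeZero.ne d hd.symm

theorem homDim_eq_of_isPreconnected {s : Set (Euc d)} (hs : IsPreconnected s)
    (hreg : ∀ x ∈ s, ∀ᶠ y in 𝓝[s] x, ∀ k, S.growth k y = S.growth k x) {x y : Euc d} (hx : x ∈ s)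
    (hy : y ∈ s) : S.homDim x = S.homDim y := by
  refine hs.constant (fun x hx => ?_) hx hy
  have hev : S.homDim =ᶠ[𝓝[s] x] fun _ => S.homDim x := by
    filter_upwards [hreg x hx] with y hy
    simp only [homDim, weight, hy]
  exact continuousWithinAt_const.congr_of_eventuallyEq hev rfl

theorem sball_subset_M (p : Euc d) (ρ : ℝ) : S.sball p ρ ⊆ S.M := fun x hx => by
  obtain ⟨τ, hτ, -⟩ := exists_joins_of_sdist_lt hx
  exact hτ.2 ▸ τ.x_mem _ (right_mem_Icc.2 τ.T_nonneg)

end DCASystem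

namespace SystemAssumptions

variable {Z : CoordSystem S} {aMin aMax σMin θMin : ℝ}

theorem aMax_pos (hS : SystemAssumptions S Z aMin aMax σMin θMin) : 0 < aMax :=
  hS.aMin_pos.trans_le hS.aMin_le

theorem tendsto_sdist (hS : SystemAssumptions S Z aMin aMax σMin θMin) {x : Euc d}
    (hx : x ∈ S.M) : Tendsto (S.sdist x) (𝓝 x) (𝓝 0) := by
  rcases eq_or_ne d 0 with rfl | hd
  · exact (tendsto_congr fun y => by rw [Subsingleton.elim y x, sdist_self hx]).2
      tendsto_const_nhds
  have : NeZero d := ⟨hd⟩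
  have hs : 0 < 1 / (S.degree x : ℝ) := one_div_pos.2 <| Nat.cast_pos.2 <| Nat.pos_of_ne_zero <|
    degree_ne_zero (hS.bracketGenerating x hx)
  have hcont : Continuous fun y =>
      ENNReal.ofReal (2 * aMax * ‖x - y‖ ^ (1 / (S.degree x : ℝ))) :=
    ENNReal.continuous_ofReal.comp <| continuous_const.mul <|
      (continuous_const.sub continuous_id).norm.rpow_const fun _ => Or.inr hs.le
  have hbound := hcont.tendsto x
  rw [sub_self, norm_zero, Real.zero_rpow hs.ne', mul_zero, ENNReal.ofReal_zero] at hbound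
  refine tendsto_of_tendsto_of_tendsto_of_le_of_le' tendsto_const_nhds hbound
    (Eventually.of_forall fun _ => zero_le) ?_
  filter_upwards [S.isOpen_M.mem_nhds hx, Metric.closedBall_mem_nhds x hS.θMin_pos] with y hy hxy
  exact (hS.distComparison x hx y hy (mem_closedBall_iff_norm'.1 hxy)).2

theorem continuousOn_sdist (hS : SystemAssumptions S Z aMin aMax σMin θMin) (p : Euc d) :
    ContinuousOn (S.sdist p) S.M := fun x hx => by
  have hsub : Tendsto (fun y => S.sdist p x - S.sdist x y) (𝓝 x) (𝓝 (S.sdist p x)) := by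
    simpa only [tsub_zero] using
      ENNReal.Tendsto.sub tendsto_const_nhds (hS.tendsto_sdist hx) (Or.inr ENNReal.zero_ne_top)
  have hadd : Tendsto (fun y => S.sdist p x + S.sdist x y) (𝓝 x) (𝓝 (S.sdist p x)) := by
    simpa only [add_zero] using tendsto_const_nhds.add (hS.tendsto_sdist hx)
  refine (tendsto_of_tendsto_of_tendsto_of_le_of_le hsub hadd (fun y => ?_)
    fun y => sdist_triangle p x y).mono_left nhdsWithin_le_nhds
  rw [tsub_le_iff_right, sdist_comm x y]
  exact sdist_triangle p y x

theorem isOpen_sball (hS : SystemAssumptions S Z aMin aMax σMin θMin) (p : Euc d) (ρ : ℝ) :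
    IsOpen (S.sball p ρ) := by
  rw [← inter_eq_self_of_subset_right (sball_subset_M p ρ)]
  exact (hS.continuousOn_sdist p).isOpen_inter_preimage S.isOpen_M isOpen_Iio

theorem box_subset_sball (hS : SystemAssumptions S Z aMin aMax σMin θMin) (p : S.M) {ρ : ℝ}
    (hρ : 0 < ρ) (hσ : ρ < σMin) (hM : Metric.closedBall (p : Euc d) ρ ⊆ S.M) :
    (Z p).box (ρ / aMax) ⊆ S.sball p ρ := by
  have hρ' : 0 < ρ / aMax := div_pos hρ hS.aMax_pos
  -- The ball-box inequality holds only near `p`; as the box is connected, it suffices that the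
  -- box contains no boundary point of the ball.
  refine ((Z p).isPreconnected_box _).subset_of_closure_inter_subset (hS.isOpen_sball p ρ)
    ⟨p, (Z p).self_mem_box hρ', mem_sball_self p.2 hρ⟩ fun x hx => ?_
  have hxM : x ∈ S.M := hM <| closure_minimal
    ((sball_subset_ball _ _).trans Metric.ball_subset_closedBall) Metric.isClosed_closedBall hx.1
  have hxρ : S.sdist p x ≤ ENNReal.ofReal ρ :=
    (((hS.continuousOn_sdist p) x hxM).mono (sball_subset_M _ _)).closure_le hx.1
      continuousWithinAt_const fun _ hy => le_of_lt hy
  have hxσ : S.sdist p x < ENNReal.ofReal σMin :=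
    hxρ.trans_lt ((ENNReal.ofReal_lt_ofReal_iff hS.σMin_pos).2 hσ)
  have hx' : (Z p).pseudonorm x < ρ / aMax := (Z p).pseudonorm_lt_of_mem_box
    (weight_ne_zero (hS.bracketGenerating p p.2)) hρ' hx.2
  exact (hS.ballBox p x hxM hxσ).2.trans_lt <| (ENNReal.ofReal_lt_ofReal_iff hρ).2 <|
    (lt_div_iff₀' hS.aMax_pos).1 hx'

end SystemAssumptions

namespace PlanningProblem

variable (P : PlanningProblem S)

theorem measurableSet_free : MeasurableSet P.free :=
  isClosed_closure.measurableSet.inter S.isOpen_M.measurableSet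

theorem diff_subset_free : S.M \ P.obs ⊆ P.free := fun _ hx => ⟨subset_closure hx, hx.1⟩

theorem volume_free_ne_zero : volume P.free ≠ 0 := fun h =>
  (P.isOpen_diff.measure_pos volume (closure_nonempty_iff.1 ⟨P.init, P.init_mem.1⟩)).ne' <|
    measure_mono_null P.diff_subset_free h

theorem isOpen_goal_inter_diff : IsOpen (P.goal ∩ (S.M \ P.obs)) := by
  obtain ⟨O, hO, hgoal⟩ := P.goal_open
  have : P.goal ∩ (S.M \ P.obs) = O ∩ (S.M \ P.obs) := by
    rw [hgoal, inter_assoc]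
    exact congrArg (O ∩ ·) (inter_eq_self_of_subset_right P.diff_subset_free)
  exact this ▸ hO.inter P.isOpen_diff

variable {P}

theorem exists_trajectory_mem_goal {Z : CoordSystem S} {aMin aMax σMin θMin : ℝ}
    (hS : SystemAssumptions S Z aMin aMax σMin θMin) {τ : Trajectory S} (hτ : P.IsFeasible τ)
    {δ : ℝ} (hclear : P.WeakClearance δ τ) {c : ℝ} (hc : τ.length < c) :
    ∃ γ : Trajectory S, γ.x 0 = P.init ∧ γ.length < c ∧ γ.x γ.T ∈ P.goal ∧
      γ.x '' Icc 0 γ.T ⊆ S.M \ P.obs := by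
  obtain ⟨-, ψ, -, -, -, hjoin, hlen, hstrong⟩ := hclear
  obtain ⟨α, hαc, hα⟩ :=
    ((hlen.eventually (gt_mem_nhds hc)).and (Ioc_mem_nhdsGT zero_lt_one)).exists
  obtain ⟨δ', hδ', -, hobs⟩ := hstrong α hα
  obtain ⟨hstart, hend⟩ := hjoin α (Ioc_subset_Icc_self hα)
  have havoid : ∀ t ∈ Icc 0 (ψ α).T, (ψ α).x t ∈ S.M \ P.obs := fun t ht =>
    ⟨(ψ α).x_mem t ht, fun h => hδ'.not_ge ((hobs t ht _ h).trans_eq (dist_self _))⟩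
  -- `ψ α` ends only in the closure of the goal, so it is prolonged by a short trajectory.
  have hendmem : τ.x τ.T ∈ S.M \ P.obs := hend ▸ havoid _ (right_mem_Icc.2 (ψ α).T_nonneg)
  obtain ⟨ρ, hρ, hball⟩ := Metric.isOpen_iff.1 P.isOpen_diff _ hendmem
  have hpos : 0 < ENNReal.ofReal (min (c - (ψ α).length) ρ) :=
    ENNReal.ofReal_pos.2 (lt_min (sub_pos.2 hαc) hρ)
  obtain ⟨y, hygoal, hy⟩ := ((mem_closure_iff_frequently.1 hτ.2.2).and_eventually
    ((hS.tendsto_sdist hendmem.1).eventually (gt_mem_nhds hpos))).exists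
  obtain ⟨τ', hτ', hlen'⟩ := exists_joins_of_sdist_lt hy
  have hglue : (ψ α).x (ψ α).T = τ'.x 0 := hend.trans hτ'.1.symm
  have havoid' : ∀ t ∈ Icc 0 τ'.T, τ'.x t ∈ S.M \ P.obs := fun t ht => by
    refine hball (Metric.mem_ball'.2 ?_)
    rw [← hτ'.1]
    exact (τ'.dist_start_le ht).trans_lt (hlen'.trans_le (min_le_right _ _))
  obtain ⟨hstart', hend'⟩ := Trajectory.joins_concat hglue
  refine ⟨_, hstart'.trans (hstart.trans hτ.2.1), ?_, (hend'.trans hτ'.2).symm ▸ hygoal, ?_⟩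
  · rw [Trajectory.length_concat]
    exact lt_sub_iff_add_lt'.1 (hlen'.trans_le (min_le_left _ _))
  · rintro _ ⟨t, ht, rfl⟩
    exact splice_mem havoid havoid' ht

end PlanningProblem

/-- There is room `κ` around `p` if the closed Euclidean ball of radius `κ` about `p` avoids the
obstacles and the steering procedure is defined for all pairs of its points. -/
def HasRoom (P : PlanningProblem S) (E : Steering S) (κ : ℝ) (p : Euc d) : Prop :=
  Metric.closedBall p κ ⊆ S.M \ P.obs ∧
    ∀ u ∈ Metric.closedBall p κ, ∀ v ∈ Metric.closedBall p κ, ∃ τ, E.edge u v = some τ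

theorem HasRoom.mono {P : PlanningProblem S} {E : Steering S} {κ κ' : ℝ} {p q : Euc d}
    (h : HasRoom P E κ p) (hκ : Metric.closedBall q κ' ⊆ Metric.closedBall p κ) :
    HasRoom P E κ' q :=
  ⟨hκ.trans h.1, fun u hu v hv => h.2 u (hκ hu) v (hκ hv)⟩

theorem exists_pos_forall_hasRoom {P : PlanningProblem S} (E : Steering S) {K : Set (Euc d)}
    (hK : IsCompact K) (hKP : K ⊆ S.M \ P.obs) : ∃ κ > 0, ∀ q ∈ K, HasRoom P E κ q := by
  choose ρ hρ hedge using E.local_defined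
  obtain ⟨κ, hκ, hleb⟩ := lebesgue_number_lemma_of_metric
    (c := fun o : S.M => Metric.ball (o : Euc d) (ρ o o.2) ∩ (S.M \ P.obs)) hK
    (fun _ => Metric.isOpen_ball.inter P.isOpen_diff) fun q hq =>
      mem_iUnion.2 ⟨⟨q, (hKP hq).1⟩, Metric.mem_ball_self (hρ _ _), hKP hq⟩
  refine ⟨κ / 2, half_pos hκ, fun q hq => ?_⟩
  obtain ⟨o, ho⟩ := hleb q hq
  have hsub := (Metric.closedBall_subset_ball (half_lt_self hκ)).trans ho
  exact ⟨fun x hx => (hsub hx).2, fun u hu v hv => hedge o o.2 u ⟨(hsub hu).2.1, (hsub hu).1⟩ v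
    ⟨(hsub hv).2.1, (hsub hv).1⟩⟩

theorem SystemAssumptions.le_cond_real_sball {Z : CoordSystem S} {aMin aMax σMin θMin : ℝ}
    (hS : SystemAssumptions S Z aMin aMax σMin θMin) (P : PlanningProblem S) {p : Euc d} {ρ : ℝ}
    (hρ : 0 < ρ) (hσ : ρ < σMin) (hp : Metric.closedBall p ρ ⊆ S.M \ P.obs) :
    (ρ / aMax) ^ S.homDim p / (volume P.free).toReal ≤
      (ProbabilityTheory.cond volume P.free).real (S.sball p ρ) := by
  have hpM : p ∈ S.M := (hp (Metric.mem_closedBall_self hρ.le)).1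
  have hρ' : 0 ≤ ρ / aMax := (div_pos hρ hS.aMax_pos).le
  have hbox : (Z ⟨p, hpM⟩).box (ρ / aMax) ⊆ S.sball p ρ :=
    hS.box_subset_sball ⟨p, hpM⟩ hρ hσ fun x hx => (hp hx).1
  have hfree : (Z ⟨p, hpM⟩).box (ρ / aMax) ⊆ P.free := hbox.trans <|
    (sball_subset_ball p ρ).trans <| Metric.ball_subset_closedBall.trans <|
      hp.trans P.diff_subset_free
  calc (ρ / aMax) ^ S.homDim p / (volume P.free).toReal
      ≤ 2 ^ d * (ρ / aMax) ^ S.homDim p / (volume P.free).toReal := by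
        gcongr
        exact le_mul_of_one_le_left (by positivity) (one_le_pow₀ one_le_two)
    _ = (ProbabilityTheory.cond volume P.free).real ((Z ⟨p, hpM⟩).box (ρ / aMax)) := by
        rw [Measure.real, ProbabilityTheory.cond_apply P.measurableSet_free,
          inter_eq_self_of_subset_right hfree, (Z ⟨p, hpM⟩).volume_box hρ', ENNReal.toReal_mul,
          ENNReal.toReal_inv, ENNReal.toReal_ofReal (by positivity), div_eq_inv_mul]
    _ ≤ _ := measureReal_mono hbox

theorem exists_walkCost_le {G : SimpleGraph (Euc d)} (u : ℕ → Euc d) (K : ℕ)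
    (hu : ∀ k < K, u k = u (k + 1) ∨ G.Adj (u k) (u (k + 1))) :
    ∃ w : G.Walk (u 0) (u K), walkCost S w ≤ ∑ k ∈ Finset.range K, S.sdist (u k) (u (k + 1)) := by
  induction K with
  | zero => exact ⟨SimpleGraph.Walk.nil, by simp [walkCost]⟩
  | succ K ih =>
    obtain ⟨w, hw⟩ := ih fun k hk => hu k (hk.trans K.lt_succ_self)
    rw [Finset.sum_range_succ]
    rcases hu K K.lt_succ_self with h | h
    · rw [← h]
      exact ⟨w, hw.trans le_self_add⟩
    · refine ⟨w.append h.toWalk, ?_⟩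
      rw [walkCost, SimpleGraph.Walk.darts_append, List.map_append, List.sum_append]
      exact add_le_add hw (by simp [SimpleGraph.Adj.toWalk])

theorem eq_or_roadmap_adj {Z : CoordSystem S} {aMin aMax σMin θMin : ℝ}
    (hS : SystemAssumptions S Z aMin aMax σMin θMin) {P : PlanningProblem S} {E : Steering S}
    {r : ℝ} (hr : 0 < r) (hrσ : r ≤ σMin) {V : Set (Euc d)} {u v : Euc d} (hu : u ∈ V)
    (hv : v ∈ V) (hroom : HasRoom P E r u) (huv : S.sdist u v < ENNReal.ofReal r) :
    u = v ∨ (roadmap P Z E aMin V r).Adj u v := by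
  refine or_iff_not_imp_left.2 fun hne => ?_
  have hu' : u ∈ Metric.closedBall u r := Metric.mem_closedBall_self hr.le
  have hv' : v ∈ Metric.closedBall u r := Metric.mem_closedBall'.2 (dist_lt_of_sdist_lt huv).le
  obtain ⟨τ, hτ⟩ := hroom.2 u hu' v hv'
  obtain ⟨hjoins, hmin⟩ := E.optimal u v τ hτ
  obtain ⟨τ', hτ', hlt⟩ := exists_joins_of_sdist_lt huv
  have hfree : ∀ t ∈ Icc 0 τ.T, τ.x t ∉ P.obs := fun t ht => by
    refine (hroom.1 (Metric.mem_closedBall'.2 ?_)).2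
    rw [← hjoins.1]
    exact (τ.dist_start_le ht).trans ((hmin τ' hτ').trans hlt.le)
  have hvM : v ∈ S.M := (hroom.1 hv').1
  have hnear : (Z ⟨v, hvM⟩).pseudonorm u < r / aMin := by
    rw [sdist_comm] at huv
    have hbox := hS.ballBox ⟨v, hvM⟩ u (hroom.1 hu').1
      (huv.trans_le (ENNReal.ofReal_le_ofReal hrσ))
    exact (lt_div_iff₀' hS.aMin_pos).2
      ((ENNReal.ofReal_lt_ofReal_iff hr).1 (hbox.1.trans_lt huv))
  rw [roadmap, SimpleGraph.fromRel_adj]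
  exact ⟨hne, Or.inr ⟨hv, ⟨⟨hu, hne⟩, hvM, hnear⟩, τ, hτ, hfree⟩⟩

theorem sum_range_add_add_succ_le {e : ℕ → ℝ} (he : ∀ k, 0 ≤ e k) (a : ℝ) (K : ℕ) :
    ∑ k ∈ Finset.range K, (e k + a + e (k + 1)) ≤ K * a + 2 * ∑ k ∈ Finset.range (K + 1), e k := by
  have hfst := Finset.sum_range_succ e K
  have hsnd := Finset.sum_range_succ' e K
  rw [Finset.sum_add_distrib, Finset.sum_add_distrib, Finset.sum_const, Finset.card_range,
    nsmul_eq_mul]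
  linarith [he 0, he K]

/-- A discrete path from the initial configuration to the goal which DPRM* with radius `r` can
follow: the algorithm succeeds as soon as there are samples near all of its points. As the chain is
chordless, small balls about its points of even (or of odd) index are pairwise disjoint. Only the
points with index at most `last` matter. -/
structure GuidingChain (P : PlanningProblem S) (E : Steering S) (r : ℝ) where
  last : ℕ
  point : ℕ → Euc d
  point_zero : point 0 = P.init
  ball_subset_goal : Metric.ball (point last) r ⊆ P.goal
  hasRoom : ∀ k, HasRoom P E (2 * r) (point k)
  homDim_eq : ∀ k, S.homDim (point k) = S.homDim P.init
  sdist_succ_le : ∀ k < last, S.sdist (point k) (point (k + 1)) ≤ ENNReal.ofReal (r / 2)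
  lt_sdist : ∀ i j, i + 1 < j → j ≤ last → ENNReal.ofReal (r / 2) < S.sdist (point i) (point j)

namespace GuidingChain

variable {P : PlanningProblem S} {E : Steering S} {r β : ℝ}

theorem exists_of_trajectory {Z : CoordSystem S} {aMin aMax σMin θMin : ℝ}
    (hS : SystemAssumptions S Z aMin aMax σMin θMin) {γ : Trajectory S} (h0 : γ.x 0 = P.init)
    (hgoal : Metric.ball (γ.x γ.T) r ⊆ P.goal) (hr : 0 < r)
    (hroom : ∀ q ∈ γ.x '' Icc 0 γ.T, HasRoom P E (2 * r) q) :
    ∃ C : GuidingChain P E r, C.last ≤ 2 * γ.length / r + 1 := by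
  have hconn : IsPreconnected (γ.x '' Icc 0 γ.T) := isPreconnected_Icc.image _ γ.continuousOn_x
  have hsub : γ.x '' Icc 0 γ.T ⊆ S.M := image_subset_iff.2 γ.x_mem
  obtain ⟨K, p, hK, hp0, hpK, hp, hstep, hchord⟩ := γ.exists_chordless_chain (half_pos hr)
  refine ⟨⟨K, p, hp0.trans h0, hpK ▸ hgoal, fun k => hroom _ (hp k), fun k => ?_, hstep, hchord⟩,
    hK.trans_eq (by field_simp)⟩
  rw [← h0, ← hp0]
  exact homDim_eq_of_isPreconnected hconn
    (fun x hx => (hS.regular x (hsub hx)).filter_mono nhdsWithin_le_nhds) (hp k) (hp 0)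

variable (C : GuidingChain P E r)

theorem closedBall_subset (k : ℕ) {ρ : ℝ} (hρ : ρ ≤ 2 * r) :
    Metric.closedBall (C.point k) ρ ⊆ S.M \ P.obs :=
  (Metric.closedBall_subset_closedBall hρ).trans (C.hasRoom k).1

theorem exists_vertices {n : ℕ} (ω : Fin n → Euc d) {e : ℕ → ℝ} (he : ∀ k, 0 < e k)
    (hω : ∀ k ≤ C.last, ∃ i, ω i ∈ S.sball (C.point k) (e k)) :
    ∃ u : ℕ → Euc d, u 0 = P.init ∧ (∀ k, u k ∈ vertices P ω) ∧
      ∀ k ≤ C.last, u k ∈ S.sball (C.point k) (e k) := by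
  obtain ⟨i₀, -⟩ := hω 0 (Nat.zero_le _)
  have : Nonempty (Fin n) := ⟨i₀⟩
  choose! i hi using hω
  refine ⟨fun k => if k = 0 then P.init else ω (i k), if_pos rfl, fun k => ?_, fun k hk => ?_⟩
  · beta_reduce
    split_ifs
    exacts [mem_insert _ _, mem_insert_of_mem _ ⟨i k, rfl⟩]
  · beta_reduce
    split_ifs with h
    · rw [h, C.point_zero]
      exact mem_sball_self P.init_mem.2 (he 0)
    · exact hi k hk

variable {Z : CoordSystem S} {aMin aMax σMin θMin : ℝ}

theorem dprmCost_le_sum (hS : SystemAssumptions S Z aMin aMax σMin θMin) (hr : 0 < r)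
    (hrσ : r ≤ σMin) {n : ℕ} (ω : Fin n → Euc d) {e : ℕ → ℝ} (he : ∀ k, 0 < e k)
    (her : ∀ k, e k ≤ r / 4) (hω : ∀ k ≤ C.last, ∃ i, ω i ∈ S.sball (C.point k) (e k)) :
    dprmCost P Z E aMin r ω ≤
      ENNReal.ofReal (C.last * (r / 2) + 2 * ∑ k ∈ Finset.range (C.last + 1), e k) := by
  obtain ⟨u, hu0, huV, hu⟩ := C.exists_vertices ω he hω
  have hdist : ∀ k ≤ C.last, dist (u k) (C.point k) < r / 4 := fun k hk =>
    (Metric.mem_ball.1 (sball_subset_ball _ _ (hu k hk))).trans_le (her k)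
  have hhop : ∀ k < C.last,
      S.sdist (u k) (u (k + 1)) < ENNReal.ofReal (e k + r / 2 + e (k + 1)) := fun k hk =>
    sdist_lt_of_mem_sball (half_pos hr).le (he k).le (he (k + 1)).le (C.sdist_succ_le k hk)
      (hu k hk.le) (hu (k + 1) hk)
  have hadj : ∀ k < C.last, u k = u (k + 1) ∨
      (roadmap P Z E aMin (vertices P ω) r).Adj (u k) (u (k + 1)) := fun k hk => by
    refine eq_or_roadmap_adj hS hr hrσ (huV k) (huV (k + 1)) ((C.hasRoom k).mono
      (Metric.closedBall_subset_closedBall' (by linarith [hdist k hk.le])))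
      ((hhop k hk).trans_le (ENNReal.ofReal_le_ofReal ?_))
    linarith [her k, her (k + 1)]
  have hgoal : u C.last ∈ P.goal :=
    C.ball_subset_goal (Metric.mem_ball.2 (by linarith [hdist C.last le_rfl]))
  obtain ⟨w, hw⟩ := exists_walkCost_le (S := S) u C.last hadj
  calc dprmCost P Z E aMin r ω
      ≤ graphCost P (roadmap P Z E aMin (vertices P ω) r) (u C.last) :=
        iInf₂_le _ ⟨huV C.last, hgoal⟩
    _ ≤ ∑ k ∈ Finset.range C.last, S.sdist (u k) (u (k + 1)) := by
        rw [graphCost, ← hu0]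
        exact (iInf_le _ w).trans hw
    _ ≤ ∑ k ∈ Finset.range C.last, ENNReal.ofReal (e k + r / 2 + e (k + 1)) :=
        Finset.sum_le_sum fun k hk => (hhop k (Finset.mem_range.1 hk)).le
    _ = ENNReal.ofReal (∑ k ∈ Finset.range C.last, (e k + r / 2 + e (k + 1))) :=
        (ENNReal.ofReal_sum_of_nonneg fun k _ => by linarith [he k, he (k + 1)]).symm
    _ ≤ _ := ENNReal.ofReal_le_ofReal (sum_range_add_add_succ_le (fun k => (he k).le) _ _)

theorem dprmCost_le (hS : SystemAssumptions S Z aMin aMax σMin θMin) (hr : 0 < r)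
    (hrσ : r ≤ σMin) (hβ : 0 < β) (hβ' : β ≤ 1 / 4) {n q : ℕ} (ω : Fin n → Euc d)
    (hhit : ∀ k ≤ C.last, ∃ i, ω i ∈ S.sball (C.point k) (r / 4))
    (hmiss : ∀ F ⊆ Finset.range (C.last + 1),
      (∀ k ∈ F, ∀ i, ω i ∉ S.sball (C.point k) (β * r)) → F.card < 2 * q) :
    dprmCost P Z E aMin r ω ≤
      ENNReal.ofReal (C.last * (r / 2) + 2 * ((C.last + 1) * (β * r)) + q * r) := by
  classical
  set e : ℕ → ℝ := fun k => if ∀ i, ω i ∉ S.sball (C.point k) (β * r) then r / 4 else β * r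
    with he
  have hβr : 0 < β * r := mul_pos hβ hr
  have hβr' : β * r ≤ r / 4 := by linarith [mul_le_mul_of_nonneg_right hβ' hr.le]
  have hpos : ∀ k, 0 < e k := fun k => by
    simp only [he]
    split_ifs <;> positivity
  have hle : ∀ k, e k ≤ r / 4 := fun k => by
    simp only [he]
    split_ifs
    exacts [le_rfl, hβr']
  refine (C.dprmCost_le_sum hS hr hrσ ω hpos hle fun k hk => ?_).trans
    (ENNReal.ofReal_le_ofReal ?_)
  · simp only [he]
    split_ifs with h
    · exact hhit k hk
    · push Not at h
      exact h
  have hsum : ∑ k ∈ Finset.range (C.last + 1), e k ≤ (C.last + 1) * (β * r) + 2 * q * (r / 4) :=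
    calc ∑ k ∈ Finset.range (C.last + 1), e k
        ≤ ∑ k ∈ Finset.range (C.last + 1),
            (β * r + if ∀ i, ω i ∉ S.sball (C.point k) (β * r) then r / 4 else 0) :=
          Finset.sum_le_sum fun k _ => by simp only [he]; split_ifs <;> linarith
      _ ≤ (C.last + 1) * (β * r) + 2 * q * (r / 4) := by
          rw [Finset.sum_add_distrib, ← Finset.sum_filter, Finset.sum_const, Finset.sum_const,
            Finset.card_range, nsmul_eq_mul, nsmul_eq_mul, Nat.cast_add_one]
          gcongr
          exact_mod_cast (hmiss _ (Finset.filter_subset _ _)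
            fun k hk => (Finset.mem_filter.1 hk).2).le
  linarith

end GuidingChain

theorem exists_pairwiseDisjoint_subset {X : Type*} {B : ℕ → Set X} {F : Finset ℕ}
    (hF : ∀ i ∈ F, ∀ j ∈ F, i + 1 < j → Disjoint (B i) (B j)) {q : ℕ} (hq : 2 * q ≤ F.card) :
    ∃ J ⊆ F, J.card = q ∧ (J : Set ℕ).PairwiseDisjoint B := by
  suffices ∃ J ⊆ F, q ≤ J.card ∧ ∀ i ∈ J, ∀ j ∈ J, Even i → Even j by
    obtain ⟨J, hJF, hqJ, hpar⟩ := this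
    obtain ⟨J', hJ', hcard⟩ := Finset.exists_subset_card_eq hqJ
    have hlt : ∀ i ∈ J', ∀ j ∈ J', i < j → Disjoint (B i) (B j) := fun i hi j hj hij => by
      have h1 := hpar i (hJ' hi) j (hJ' hj)
      have h2 := hpar j (hJ' hj) i (hJ' hi)
      exact hF i (hJF (hJ' hi)) j (hJF (hJ' hj)) (by grind)
    refine ⟨J', hJ'.trans hJF, hcard, fun i hi j hj hij => ?_⟩
    rcases lt_or_gt_of_ne hij with h | h
    exacts [hlt i hi j hj h, (hlt j hj i hi h).symm]
  have hcard := Finset.card_filter_add_card_filter_not (s := F) Even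
  rcases le_or_gt q (F.filter Even).card with h | h
  · exact ⟨_, Finset.filter_subset _ _, h, fun _ _ j hj _ => (Finset.mem_filter.1 hj).2⟩
  · exact ⟨F.filter (¬ Even ·), Finset.filter_subset _ _, by omega, fun i hi _ _ hi' =>
      absurd hi' (Finset.mem_filter.1 hi).2⟩

section Sampling

variable {X : Type*} [MeasurableSpace X] (ν : Measure X) [IsProbabilityMeasure ν]

theorem pi_real_forall_notMem_le {B : Set X} (hB : MeasurableSet B) {b : ℝ} (hb : b ≤ ν.real B)
    (ι : Type*) [Fintype ι] :
    (Measure.pi fun _ : ι => ν).real {ω | ∀ i, ω i ∉ B} ≤ Real.exp (-(Fintype.card ι * b)) := by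
  have hpi : {ω : ι → X | ∀ i, ω i ∉ B} = univ.pi fun _ => Bᶜ := by
    ext ω
    simp only [mem_ofPred_eq, mem_univ_pi, mem_compl_iff]
  rw [hpi, Measure.real, Measure.pi_pi, Finset.prod_const, Finset.card_univ, ENNReal.toReal_pow,
    ← mul_neg, Real.exp_nat_mul]
  change ν.real Bᶜ ^ Fintype.card ι ≤ _
  rw [probReal_compl_eq_one_sub hB]
  exact pow_le_pow_left₀ (sub_nonneg.2 measureReal_le_one)
    ((sub_le_sub_left hb 1).trans (Real.one_sub_le_exp_neg b)) _

theorem pi_real_exists_forall_notMem_le {κ : Type*} (s : Finset κ) {B : κ → Set X}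
    (hB : ∀ k ∈ s, MeasurableSet (B k)) {b : ℝ} (hb : ∀ k ∈ s, b ≤ ν.real (B k))
    (ι : Type*) [Fintype ι] :
    (Measure.pi fun _ : ι => ν).real {ω | ∃ k ∈ s, ∀ i, ω i ∉ B k} ≤
      s.card * Real.exp (-(Fintype.card ι * b)) := by
  have hunion : {ω : ι → X | ∃ k ∈ s, ∀ i, ω i ∉ B k} = ⋃ k ∈ s, {ω | ∀ i, ω i ∉ B k} := by
    ext ω
    simp only [mem_ofPred_eq, mem_iUnion, exists_prop]
  rw [hunion, ← nsmul_eq_mul]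
  exact (measureReal_biUnion_finset_le _ _).trans <| Finset.sum_le_card_nsmul _ _ _ fun k hk =>
    pi_real_forall_notMem_le ν (hB k hk) (hb k hk) ι

theorem pi_real_exists_subset_forall_notMem_le (s : Finset ℕ) {B : ℕ → Set X}
    (hB : ∀ k ∈ s, MeasurableSet (B k))
    (hdisj : ∀ i ∈ s, ∀ j ∈ s, i + 1 < j → Disjoint (B i) (B j)) {b : ℝ}
    (hb : ∀ k ∈ s, b ≤ ν.real (B k)) (q : ℕ) (ι : Type*) [Fintype ι] :
    (Measure.pi fun _ : ι => ν).real
        {ω | ∃ F ⊆ s, 2 * q ≤ F.card ∧ ∀ k ∈ F, ∀ i, ω i ∉ B k} ≤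
      2 ^ s.card * Real.exp (-(Fintype.card ι * (q * b))) := by
  classical
  set T : Finset (Finset ℕ) :=
    s.powerset.filter fun J => J.card = q ∧ (J : Set ℕ).PairwiseDisjoint B with hT
  have hmem : ∀ J, J ∈ T ↔ J ⊆ s ∧ J.card = q ∧ (J : Set ℕ).PairwiseDisjoint B := fun J => by
    rw [hT, Finset.mem_filter, Finset.mem_powerset]
  have hsub : {ω : ι → X | ∃ F ⊆ s, 2 * q ≤ F.card ∧ ∀ k ∈ F, ∀ i, ω i ∉ B k} ⊆
      {ω | ∃ J ∈ T, ∀ i, ω i ∉ ⋃ k ∈ J, B k} := by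
    rintro ω ⟨F, hF, hcard, hω⟩
    obtain ⟨J, hJ, hJT⟩ :=
      exists_pairwiseDisjoint_subset (fun i hi j hj => hdisj i (hF hi) j (hF hj)) hcard
    refine ⟨J, (hmem J).2 ⟨hJ.trans hF, hJT⟩, fun i hi => ?_⟩
    obtain ⟨k, hk, hik⟩ := mem_iUnion₂.1 hi
    exact hω k (hJ hk) i hik
  have hlower : ∀ J ∈ T, q * b ≤ ν.real (⋃ k ∈ J, B k) := fun J hJ => by
    obtain ⟨hJs, hcard, hpair⟩ := (hmem J).1 hJ
    rw [measureReal_biUnion_finset hpair fun k hk => hB k (hJs hk), ← hcard, ← nsmul_eq_mul]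
    exact Finset.card_nsmul_le_sum _ _ _ fun k hk => hb k (hJs hk)
  have hcard : (T.card : ℝ) ≤ 2 ^ s.card := by
    exact_mod_cast (Finset.card_filter_le _ _).trans_eq s.card_powerset
  calc _ ≤ (Measure.pi fun _ : ι => ν).real {ω | ∃ J ∈ T, ∀ i, ω i ∉ ⋃ k ∈ J, B k} :=
        measureReal_mono hsub
    _ ≤ T.card * Real.exp (-(Fintype.card ι * (q * b))) :=
        pi_real_exists_forall_notMem_le ν T
          (fun J hJ => J.measurableSet_biUnion fun k hk => hB k (((hmem J).1 hJ).1 hk)) hlower ι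
    _ ≤ 2 ^ s.card * Real.exp (-(Fintype.card ι * (q * b))) := by gcongr

end Sampling

/-- A lower bound for the probability that a uniformly distributed point of the free space lies in
the sub-Riemannian ball of radius `ρ` about a point away from the obstacles: the volume of a ball
is at least that of the coordinate box of size `ρ / aMax`. -/
noncomputable def hitRate (P : PlanningProblem S) (aMax ρ : ℝ) : ℝ :=
  (ρ / aMax) ^ S.homDim P.init / (volume P.free).toReal

theorem hitRate_mul (P : PlanningProblem S) (aMax s ρ : ℝ) :
    hitRate P aMax (s * ρ) = s ^ S.homDim P.init * hitRate P aMax ρ := by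
  rw [hitRate, hitRate, mul_div_assoc s, mul_pow, mul_div_assoc]

theorem PlanningProblem.isProbabilityMeasure_cond_free {P : PlanningProblem S}
    (hfin : volume P.free ≠ ⊤) :
    IsProbabilityMeasure (ProbabilityTheory.cond (volume : Measure (Euc d)) P.free) :=
  ProbabilityTheory.cond_isProbabilityMeasure_of_finite P.volume_free_ne_zero hfin

namespace GuidingChain

variable {P : PlanningProblem S} {E : Steering S} {r : ℝ} (C : GuidingChain P E r)
  {Z : CoordSystem S} {aMin aMax σMin θMin : ℝ}

theorem hitRate_le (hS : SystemAssumptions S Z aMin aMax σMin θMin) (hrσ : r ≤ σMin) {ρ : ℝ}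
    (hρ : 0 < ρ) (hρr : ρ < r) (k : ℕ) :
    hitRate P aMax ρ ≤
      (ProbabilityTheory.cond volume P.free).real (S.sball (C.point k) ρ) := by
  rw [hitRate, ← C.homDim_eq k]
  exact hS.le_cond_real_sball P hρ (hρr.trans_le hrσ) (C.closedBall_subset k (by linarith))

theorem setOf_lt_dprmCost_subset (hS : SystemAssumptions S Z aMin aMax σMin θMin) (hr : 0 < r)
    (hrσ : r ≤ σMin) {β : ℝ} (hβ : 0 < β) (hβ' : β ≤ 1 / 4) (q n : ℕ) :
    {ω : Fin n → Euc d |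
        ENNReal.ofReal (C.last * (r / 2) + 2 * ((C.last + 1) * (β * r)) + q * r) <
          dprmCost P Z E aMin r ω} ⊆
      {ω | ∃ k ∈ Finset.range (C.last + 1), ∀ i, ω i ∉ S.sball (C.point k) (r / 4)} ∪
      {ω | ∃ F ⊆ Finset.range (C.last + 1), 2 * q ≤ F.card ∧
        ∀ k ∈ F, ∀ i, ω i ∉ S.sball (C.point k) (β * r)} := by
  intro ω hω
  by_contra hgood
  simp only [mem_union, mem_ofPred_eq, not_or, not_exists, not_and, Finset.mem_range_succ_iff,
    not_forall, not_not] at hgood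
  refine hω.not_ge (C.dprmCost_le hS hr hrσ hβ hβ' ω hgood.1 fun F hF hmiss => ?_)
  by_contra! hcard
  obtain ⟨k, hk, i, hi⟩ := hgood.2 F hF hcard
  exact hmiss k hk i hi

theorem sampleFree_real_lt_dprmCost_le (hS : SystemAssumptions S Z aMin aMax σMin θMin)
    (hfin : volume P.free ≠ ⊤) (hr : 0 < r) (hrσ : r ≤ σMin) {β : ℝ} (hβ : 0 < β)
    (hβ' : β ≤ 1 / 4) (q n : ℕ) :
    (sampleFree P n).real
        {ω | ENNReal.ofReal (C.last * (r / 2) + 2 * ((C.last + 1) * (β * r)) + q * r) <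
          dprmCost P Z E aMin r ω} ≤
      (C.last + 1) * Real.exp (-(n * hitRate P aMax (r / 4))) +
        2 ^ (C.last + 1) * Real.exp (-(n * (q * hitRate P aMax (β * r)))) := by
  have := PlanningProblem.isProbabilityMeasure_cond_free hfin
  have hβr : β * r ≤ r / 4 := by linarith [mul_le_mul_of_nonneg_right hβ' hr.le]
  have hmeas : ∀ ρ, ∀ k ∈ Finset.range (C.last + 1), MeasurableSet (S.sball (C.point k) ρ) :=
    fun ρ k _ => (hS.isOpen_sball _ _).measurableSet
  have hdisj : ∀ i ∈ Finset.range (C.last + 1), ∀ j ∈ Finset.range (C.last + 1), i + 1 < j →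
      Disjoint (S.sball (C.point i) (β * r)) (S.sball (C.point j) (β * r)) :=
    fun i _ j hj hij => disjoint_sball <| by
      rw [← ENNReal.ofReal_add (by positivity) (by positivity)]
      exact (ENNReal.ofReal_le_ofReal (by linarith)).trans
        (C.lt_sdist i j hij (Finset.mem_range_succ_iff.1 hj)).le
  have hbig := pi_real_exists_forall_notMem_le (ProbabilityTheory.cond volume P.free)
    (Finset.range (C.last + 1)) (hmeas (r / 4))
    (fun k _ => C.hitRate_le hS hrσ (by positivity) (by linarith) k) (Fin n)
  have hsmall := pi_real_exists_subset_forall_notMem_le (ProbabilityTheory.cond volume P.free)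
    (Finset.range (C.last + 1)) (hmeas (β * r)) hdisj
    (fun k _ => C.hitRate_le hS hrσ (by positivity) (by linarith) k) q (Fin n)
  simp only [Finset.card_range, Fintype.card_fin, Nat.cast_add_one] at hbig hsmall
  have : IsProbabilityMeasure (sampleFree P n) := Measure.pi.instIsProbabilityMeasure _
  exact (measureReal_mono (C.setOf_lt_dprmCost_subset hS hr hrσ hβ hβ' q n)).trans
    ((measureReal_union_le _ _).trans (add_le_add hbig hsmall))

end GuidingChain

theorem eventually_exists_guidingChain {Z : CoordSystem S} {aMin aMax σMin θMin : ℝ}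
    (hS : SystemAssumptions S Z aMin aMax σMin θMin) {P : PlanningProblem S} (E : Steering S)
    {γ : Trajectory S} (h0 : γ.x 0 = P.init) (hgoal : γ.x γ.T ∈ P.goal)
    (hfree : γ.x '' Icc 0 γ.T ⊆ S.M \ P.obs) :
    ∀ᶠ r in 𝓝[>] (0 : ℝ), ∃ C : GuidingChain P E r, C.last ≤ 2 * γ.length / r + 1 := by
  obtain ⟨κ, hκ, hroom⟩ := exists_pos_forall_hasRoom E
    (isCompact_Icc.image_of_continuousOn γ.continuousOn_x) hfree
  obtain ⟨ρ, hρ, hball⟩ := Metric.isOpen_iff.1 P.isOpen_goal_inter_diff _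
    ⟨hgoal, hfree ⟨γ.T, right_mem_Icc.2 γ.T_nonneg, rfl⟩⟩
  filter_upwards [Ioo_mem_nhdsGT (half_pos hκ), Ioo_mem_nhdsGT hρ] with r hrκ hrρ
  exact GuidingChain.exists_of_trajectory hS h0
    (fun x hx => (hball (Metric.ball_subset_ball hrρ.2.le hx)).1) hrκ.1 fun q hq =>
      (hroom q hq).mono (Metric.closedBall_subset_closedBall (by linarith [hrκ.2]))

theorem chain_cost_le {L c r β K q : ℝ} (hr : 0 < r) (hr1 : r ≤ 1) (hrc : r ≤ (c - L) / 16)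
    (hβ : 0 ≤ β) (hβL : β * (16 * (L + 1)) ≤ c - L) (hK : K ≤ 2 * L / r + 1)
    (hq : q ≤ (c - L) / 4 / r + 1) : K * (r / 2) + 2 * ((K + 1) * (β * r)) + q * r ≤ c := by
  have hKr : K * r ≤ 2 * L + r :=
    (mul_le_mul_of_nonneg_right hK hr.le).trans_eq (by field_simp)
  have hqr : q * r ≤ (c - L) / 4 + r :=
    (mul_le_mul_of_nonneg_right hq hr.le).trans_eq (by field_simp)
  have hβK : (K + 1) * (β * r) ≤ (c - L) / 8 := by
    calc (K + 1) * (β * r) = β * (K * r + r) := by ring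
      _ ≤ β * (2 * (L + 1)) := mul_le_mul_of_nonneg_left (by linarith) hβ
      _ ≤ (c - L) / 8 := by linarith
  linarith

theorem two_pow_le_exp (n : ℕ) : (2 : ℝ) ^ n ≤ Real.exp n := by
  rw [← mul_one (n : ℝ), Real.exp_nat_mul]
  exact pow_le_pow_left₀ zero_le_two (by linarith [Real.add_one_le_exp 1]) n

theorem exists_failure_bound {Z : CoordSystem S} {aMin aMax σMin θMin : ℝ}
    (hS : SystemAssumptions S Z aMin aMax σMin θMin) {P : PlanningProblem S}
    (hfin : volume P.free ≠ ⊤) (E : Steering S) {γ : Trajectory S} (h0 : γ.x 0 = P.init)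
    (hgoal : γ.x γ.T ∈ P.goal) (hfree : γ.x '' Icc 0 γ.T ⊆ S.M \ P.obs) {c : ℝ}
    (hc : γ.length < c) :
    ∃ A b : ℝ, 0 < b ∧ ∀ᶠ r in 𝓝[>] (0 : ℝ), ∀ n : ℕ,
      (sampleFree P n).real {ω | ENNReal.ofReal c < dprmCost P Z E aMin r ω} ≤
        A / r * Real.exp (-(n * hitRate P aMax (r / 4))) +
          Real.exp (A / r - b / r * (n * hitRate P aMax (r / 4))) := by
  set L := γ.length
  have hL : 0 ≤ L := γ.length_nonneg
  have hg : 0 < c - L := sub_pos.2 hc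
  obtain ⟨β, hβ, hβlt⟩ :=
    exists_between (lt_min (show (0 : ℝ) < 1 / 4 by norm_num)
      (div_pos hg (show 0 < 16 * (L + 1) by positivity)))
  rw [lt_min_iff, lt_div_iff₀ (show 0 < 16 * (L + 1) by positivity)] at hβlt
  refine ⟨2 * L + 2, (c - L) / 4 * (4 * β) ^ S.homDim P.init, by positivity, ?_⟩
  filter_upwards [eventually_exists_guidingChain hS E h0 hgoal hfree, Ioo_mem_nhdsGT hS.σMin_pos,
    Ioo_mem_nhdsGT zero_lt_one, Ioo_mem_nhdsGT (show 0 < (c - L) / 16 by positivity)]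
    with r ⟨C, hC⟩ ⟨hr, hrσ⟩ ⟨_, hr1⟩ ⟨_, hrc⟩ n
  set q := ⌈(c - L) / 4 / r⌉₊
  set h := hitRate P aMax (r / 4)
  have hh : 0 ≤ h := by have := hS.aMax_pos; simp only [h, hitRate]; positivity
  have hlast : (C.last + 1 : ℝ) ≤ (2 * L + 2) / r := by
    rw [le_div_iff₀ hr]
    linarith [(mul_le_mul_of_nonneg_right hC hr.le).trans_eq
      (show (2 * L / r + 1) * r = 2 * L + r by field_simp)]
  have hcost : C.last * (r / 2) + 2 * ((C.last + 1) * (β * r)) + q * r ≤ c :=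
    chain_cost_le hr hr1.le hrc.le hβ.le hβlt.2.le hC (Nat.ceil_lt_add_one (by positivity)).le
  have hpow : (2 : ℝ) ^ (C.last + 1) ≤ Real.exp ((2 * L + 2) / r) :=
    (two_pow_le_exp _).trans (Real.exp_le_exp.2 (by rwa [Nat.cast_add_one]))
  have hrate : (c - L) / 4 * (4 * β) ^ S.homDim P.init / r * (n * h) ≤
      n * (q * hitRate P aMax (β * r)) := by
    calc _ = n * ((c - L) / 4 / r * ((4 * β) ^ S.homDim P.init * h)) := by ring
      _ ≤ n * (q * ((4 * β) ^ S.homDim P.init * h)) := by gcongr; exact Nat.le_ceil _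
      _ = _ := by rw [← hitRate_mul, show 4 * β * (r / 4) = β * r by ring]
  have := PlanningProblem.isProbabilityMeasure_cond_free hfin
  have : IsProbabilityMeasure (sampleFree P n) := Measure.pi.instIsProbabilityMeasure _
  calc _ ≤ _ := measureReal_mono fun ω hω => (ENNReal.ofReal_le_ofReal hcost).trans_lt hω
    _ ≤ _ := C.sampleFree_real_lt_dprmCost_le hS hfin hr hrσ.le hβ hβlt.1.le q n
    _ ≤ _ := by
      rw [sub_eq_add_neg, Real.exp_add]
      gcongr

theorem isBigO_exp_neg_div_add_exp {ι : Type*} {l : Filter ι} {L r : ι → ℝ} (hL : Tendsto L l atTop)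
    (hr : Tendsto r l (𝓝[>] 0)) (A : ℝ) {b : ℝ} (hb : 0 < b) :
    (fun i => A / r i * Real.exp (-L i) + Real.exp (A / r i - b / r i * L i)) =O[l]
      fun i => Real.exp (-L i) / r i := by
  have hexp : (fun i => Real.exp (A / r i - b / r i * L i)) =O[l]
      fun i => Real.exp (-L i) / r i := by
    refine IsBigO.of_bound' ?_
    filter_upwards [hr.eventually (Ioo_mem_nhdsGT (half_pos hb)),
      hr.eventually (Ioo_mem_nhdsGT one_pos), hL.eventually_ge_atTop (A / (b / 2)),
      hL.eventually_ge_atTop 0] with i ⟨hr0, hrb⟩ ⟨_, hr1⟩ hLA hL0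
    rw [Real.norm_of_nonneg (Real.exp_pos _).le, Real.norm_of_nonneg (by positivity)]
    have hle : A - b * L i ≤ -L i * r i := by
      linarith [(div_le_iff₀ (half_pos hb)).1 hLA, mul_le_mul_of_nonneg_left hrb.le hL0]
    calc Real.exp (A / r i - b / r i * L i) ≤ Real.exp (-L i) := by
          rwa [Real.exp_le_exp, div_mul_eq_mul_div, ← sub_div, div_le_iff₀ hr0]
      _ ≤ Real.exp (-L i) / r i := le_div_self (Real.exp_pos _).le hr0 hr1.le
  refine IsBigO.add ?_ hexp
  simpa only [div_mul_eq_mul_div, mul_div_assoc] using isBigO_const_mul_self A _ l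

theorem isBigO_failure {Z : CoordSystem S} {aMin aMax σMin θMin : ℝ}
    (hS : SystemAssumptions S Z aMin aMax σMin θMin) {P : PlanningProblem S}
    (hfin : volume P.free ≠ ⊤) (E : Steering S) {τ : Trajectory S} (hτ : P.IsFeasible τ) {δ : ℝ}
    (hclear : P.WeakClearance δ τ) {c : ℝ} (hc : τ.length < c) {r : ℕ → ℝ}
    (hr : Tendsto r atTop (𝓝[>] 0))
    (hrate : Tendsto (fun n : ℕ => n * hitRate P aMax (r n / 4)) atTop atTop) :
    (fun n : ℕ => (sampleFree P n).real {ω | ENNReal.ofReal c < dprmCost P Z E aMin (r n) ω})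
      =O[atTop] fun n : ℕ => Real.exp (-(n * hitRate P aMax (r n / 4))) / r n := by
  obtain ⟨γ, h0, hγc, hγgoal, hγfree⟩ := P.exists_trajectory_mem_goal hS hτ hclear hc
  obtain ⟨A, b, hb, hbound⟩ := exists_failure_bound hS hfin E h0 hγgoal hγfree hγc
  refine IsBigO.trans (IsBigO.of_bound' ?_) (isBigO_exp_neg_div_add_exp hrate hr A hb)
  filter_upwards [hr.eventually hbound] with n hn
  rw [Real.norm_of_nonneg measureReal_nonneg]
  exact (hn n).trans (Real.le_norm_self _)

theorem tendsto_log_div_natCast_nhdsGT :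
    Tendsto (fun n : ℕ => Real.log n / n) atTop (𝓝[>] 0) := by
  refine tendsto_nhdsWithin_iff.2 ⟨Real.isLittleO_log_id_atTop.tendsto_div_nhds_zero.comp
    tendsto_natCast_atTop_atTop, ?_⟩
  filter_upwards [eventually_gt_atTop 1] with n hn
  exact div_pos (Real.log_pos (Nat.one_lt_cast.2 hn)) (Nat.cast_pos.2 (one_pos.trans hn))

section Radius

variable {P : PlanningProblem S} {aMax η : ℝ}

theorem exists_radius_eq (hfin : volume P.free ≠ ⊤) (hD : 0 < S.homDim P.init) (hA : 0 < aMax)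
    (hη : -1 < η) : ∃ C > 0, ∀ n : ℕ,
      radius P aMax η n = C * (Real.log n / n) ^ (1 / (S.homDim P.init : ℝ)) := by
  have hμ := ENNReal.toReal_pos P.volume_free_ne_zero hfin
  have h1η : 0 < 1 + η := by linarith
  exact ⟨_, by positivity, fun n => rfl⟩

theorem tendsto_radius (hfin : volume P.free ≠ ⊤) (hD : 0 < S.homDim P.init) (hA : 0 < aMax)
    (hη : -1 < η) : Tendsto (radius P aMax η) atTop (𝓝[>] 0) := by
  obtain ⟨C, hC, hr⟩ := exists_radius_eq hfin hD hA hη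
  have hD' : 0 < 1 / (S.homDim P.init : ℝ) := by positivity
  obtain ⟨hlim, hpos⟩ := tendsto_nhdsWithin_iff.1 tendsto_log_div_natCast_nhdsGT
  refine tendsto_nhdsWithin_iff.2 ⟨?_, ?_⟩
  · simpa only [Real.zero_rpow hD'.ne', mul_zero, ← hr] using
      (hlim.rpow_const (Or.inr hD'.le)).const_mul C
  · filter_upwards [hpos] with n hn
    rw [hr]
    exact mul_pos hC (Real.rpow_pos_of_pos hn _)

theorem natCast_mul_hitRate_radius (hfin : volume P.free ≠ ⊤) (hD : 0 < S.homDim P.init)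
    (hA : 0 < aMax) (hη : -1 < η) {n : ℕ} (hn : n ≠ 0) :
    n * hitRate P aMax (radius P aMax η n / 4) = (1 + η) / S.homDim P.init * Real.log n := by
  have hμ := ENNReal.toReal_pos P.volume_free_ne_zero hfin
  have h1η : 0 ≤ 1 + η := by linarith
  have hpow : ∀ x : ℝ, 0 ≤ x → (x ^ (1 / (S.homDim P.init : ℝ))) ^ S.homDim P.init = x :=
    fun x hx => by rw [one_div, Real.rpow_inv_natCast_pow hx hD.ne']
  have hscale : radius P aMax η n / 4 / aMax = (1 + η) ^ (1 / (S.homDim P.init : ℝ)) *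
      ((volume P.free).toReal / S.homDim P.init) ^ (1 / (S.homDim P.init : ℝ)) *
      (Real.log n / n) ^ (1 / (S.homDim P.init : ℝ)) := by
    rw [radius]
    field_simp
  rw [hitRate, hscale, mul_pow, mul_pow, hpow _ h1η, hpow _ (by positivity), hpow _ (by positivity)]
  field_simp

theorem isBigO_exp_neg_div_radius (hfin : volume P.free ≠ ⊤) (hD : 0 < S.homDim P.init)
    (hA : 0 < aMax) (hη : -1 < η) :
    (fun n : ℕ => Real.exp (-((1 + η) / S.homDim P.init * Real.log n)) / radius P aMax η n)
      =O[atTop] fun n : ℕ => (n : ℝ) ^ (-(η / (S.homDim P.init : ℝ))) *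
        Real.log n ^ (-(1 / (S.homDim P.init : ℝ))) := by
  obtain ⟨C, hC, hr⟩ := exists_radius_eq hfin hD hA hη
  refine IsBigO.trans (EventuallyEq.isBigO ?_) (isBigO_const_mul_self C⁻¹ _ _)
  filter_upwards [eventually_gt_atTop 1] with n hn
  have hn0 : 0 < (n : ℝ) := Nat.cast_pos.2 (one_pos.trans hn)
  have hlog : 0 < Real.log n := Real.log_pos (Nat.one_lt_cast.2 hn)
  have hexp : Real.exp (-((1 + η) / S.homDim P.init * Real.log n)) =
      (n : ℝ) ^ (-(η / (S.homDim P.init : ℝ))) / (n : ℝ) ^ (1 / (S.homDim P.init : ℝ)) := by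
    rw [← Real.rpow_sub hn0, Real.rpow_def_of_pos hn0]
    ring_nf
  rw [hr, hexp, Real.div_rpow hlog.le hn0.le, Real.rpow_neg hlog.le]
  field_simp

end Radius

theorem dprmCost_eq_zero_of_init_mem {P : PlanningProblem S} (h : P.init ∈ P.goal)
    (Z : CoordSystem S) (E : Steering S) (aMin r : ℝ) {n : ℕ} (ω : Fin n → Euc d) :
    dprmCost P Z E aMin r ω = 0 :=
  nonpos_iff_eq_zero.1 <| (iInf₂_le P.init ⟨mem_insert _ _, h⟩).trans
    (iInf_le (fun w => walkCost S w) SimpleGraph.Walk.nil)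

theorem sampleFree_real_lt_dprmCost_eq_zero_of_init_mem {P : PlanningProblem S}
    (h : P.init ∈ P.goal) (Z : CoordSystem S) (E : Steering S) (aMin r c : ℝ) (n : ℕ) :
    (sampleFree P n).real {ω | ENNReal.ofReal c < dprmCost P Z E aMin r ω} = 0 := by
  simp only [dprmCost_eq_zero_of_init_mem h, not_lt_zero, ofPred_false, measureReal_empty]

theorem PlanningProblem.IsFeasible.init_mem_goal_or_length_pos {P : PlanningProblem S}
    {τ : Trajectory S} (hτ : P.IsFeasible τ) (hinit : P.init ∈ closure P.goal → P.init ∈ P.goal) :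
    P.init ∈ P.goal ∨ 0 < τ.length := by
  refine τ.length_nonneg.eq_or_lt.imp_left fun h => hinit ?_
  have hdist := τ.dist_start_le (right_mem_Icc.2 τ.T_nonneg)
  rw [← h, dist_le_zero, hτ.2.1] at hdist
  exact hdist ▸ hτ.2.2

end DPRM

theorem mainTheorem4_general {d m : ℕ} {S : DPRM.DCASystem d m} {Z : DPRM.CoordSystem S}
    {aMin aMax σMin θMin : ℝ} (hS : DPRM.SystemAssumptions S Z aMin aMax σMin θMin)
    {P : DPRM.PlanningProblem S} (hfin : volume P.free ≠ ⊤) {τ : DPRM.Trajectory S}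
    (hτ : P.IsFeasible τ) {δ : ℝ} (hclear : P.WeakClearance δ τ) (E : DPRM.Steering S) {η : ℝ}
    (hη : -1 < η) {c : ℝ} (hc : τ.length < c) :
    (fun n : ℕ => (DPRM.sampleFree P n).real
        {ω | ENNReal.ofReal c < DPRM.dprmCost P Z E aMin (DPRM.radius P aMax η n) ω})
      =O[atTop] fun n : ℕ => (n : ℝ) ^ (-(η / (S.homDim P.init : ℝ))) *
        (Real.log n) ^ (-(1 / (S.homDim P.init : ℝ))) := by
  by_cases hgoal : P.init ∈ P.goal
  · simpa only [DPRM.sampleFree_real_lt_dprmCost_eq_zero_of_init_mem hgoal] using isBigO_zero _ _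
  have : NeZero d := ⟨by
    rintro rfl
    obtain ⟨z, hz⟩ := closure_nonempty_iff.1 ⟨_, hτ.2.2⟩
    exact hgoal (Subsingleton.elim z P.init ▸ hz)⟩
  have hD : 0 < S.homDim P.init :=
    DPRM.DCASystem.homDim_pos (hS.bracketGenerating P.init P.init_mem.2)
  have hrate : (fun n : ℕ => n * DPRM.hitRate P aMax (DPRM.radius P aMax η n / 4)) =ᶠ[atTop]
      fun n : ℕ => (1 + η) / S.homDim P.init * Real.log n := by
    filter_upwards [eventually_ne_atTop 0] with n hn
    exact DPRM.natCast_mul_hitRate_radius hfin hD hS.aMax_pos hη hn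
  have hlog : Tendsto (fun n : ℕ => (1 + η) / S.homDim P.init * Real.log n) atTop atTop :=
    (Real.tendsto_log_atTop.comp tendsto_natCast_atTop_atTop).const_mul_atTop
      (div_pos (by linarith) (Nat.cast_pos.2 hD))
  calc _ =O[atTop] _ := DPRM.isBigO_failure hS hfin E hτ hclear hc
          (DPRM.tendsto_radius hfin hD hS.aMax_pos hη) (hlog.congr' hrate.symm)
    _ =ᶠ[atTop] _ := by filter_upwards [hrate] with n hn; rw [hn]
    _ =O[atTop] _ := DPRM.isBigO_exp_neg_div_radius hfin hD hS.aMax_pos hη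

theorem mainTheorem4 {d m : ℕ} (S : DPRM.DCASystem d m) (Z : DPRM.CoordSystem S)
    (aMin aMax σMin θMin : ℝ) (hS : DPRM.SystemAssumptions S Z aMin aMax σMin θMin)
    (P : DPRM.PlanningProblem S) (hfin : volume P.free ≠ ⊤)
    (ξ : ℝ) (hξ : 0 < ξ) (hgoal : P.GoalRegular ξ)
    (hinit : P.init ∈ closure P.goal → P.init ∈ P.goal)
    (xStar : DPRM.Trajectory S) (hopt : P.IsOptimal xStar)
    (δ : ℝ) (hδ : 0 < δ) (hclear : P.WeakClearance δ xStar)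
    (E : DPRM.Steering S) (η : ℝ) (hη : 0 ≤ η) (ε : ℝ) (hε : 0 < ε) :
    (fun n : ℕ => (DPRM.sampleFree P n).real
        {ω | ENNReal.ofReal ((1 + ε) * xStar.length) <
          DPRM.dprmCost P Z E aMin (DPRM.radius P aMax η n) ω})
      =O[atTop] fun n : ℕ => (n : ℝ) ^ (-(η / (S.homDim P.init : ℝ))) *
        (Real.log n) ^ (-(1 / (S.homDim P.init : ℝ))) := by
  rcases hopt.1.init_mem_goal_or_length_pos hinit with hmem | hpos
  · simpa only [DPRM.sampleFree_real_lt_dprmCost_eq_zero_of_init_mem hmem] using isBigO_zero _ _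
  · exact mainTheorem4_general hS hfin hopt.1 hclear E (by linarith)
      (lt_mul_of_one_lt_left hpos (by linarith))
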